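/- **Model.** Fix a sampling period $t>0$, a probability space, $N$ drones and $M$ targets. Put $$A_2=\begin{bmatrix} I_2& tI_2\\ 0& I_2\end{bmatrix},\quad B_2=\begin{bmatrix}\tfrac12t^2I_2\\ tI_2\end{bmatrix},\quad F=\begin{bmatrix}1&0&0\\0&1&0\end{bmatrix}.$$ Drone $h$ has a random position $x_h^{(k)}\in\mathbb R^3$, velocity $v_h^{(k)}$ and acceleration $u_h^{(k)}$ with $x_h^{(k+1)}=x_h^{(k)}+tv_h^{(k)}+\tfrac12t^2u_h^{(k)}$, $v_h^{(k+1)}=v_h^{(k)}+tu_h^{(k)}$. Target $j$ has the state $\eta_j=(s_j,\nu_j)\in\mathbb R^4$ with $\eta_j^{(k+1)}=A_2\eta_j^{(k)}+B_2\omega_j^{(k)}$, $\omega_j^{(k)}\sim\mathcal N(0,Q_j)$. Two drones $i=i(j)$, $g=g(j)$ are assigned to target $j$; they measure $d_{h,j}=\|Fx_h-s_j\|+\varepsilon_{h,j}$ ($h=i,g$) with $\varepsilon_{h,j}^{(k)}\sim\mathcal N(0,q_h)$, $q_h>0$, where at each instant $\varepsilon_{i,j},\varepsilon_{g,j}$ are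 independent of each other and jointly independent of the current $(x_i,x_g,\eta_j)$. Let $p_{i,g}=x_i-x_g$, $C_{i,g}=[-2p_{i,g}^\top F^\top,\,0_{1\times2}]$, $$\theta_{i,g,j}=d_{i,j}^2-d_{g,j}^2-x_i^\top F^\top Fx_i+x_g^\top F^\top Fx_g,$$ $$\bar\varepsilon_{i,g,j}=\varepsilon_{i,j}^2-\varepsilon_{g,j}^2+2\|Fx_i-s_j\|\varepsilon_{i,j}-2\|Fx_g-s_j\|\varepsilon_{g,j},\qquad \Upsilon_{i,g,j}=\mathrm{Var}\{\bar\varepsilon_{i,g,j}\},$$ and let $\hat\Upsilon_{i,g,j}^{(k)}$ be the (possibly random) estimate of $\Upsilon_{i,g,j}^{(k)}$ that is available to the estimator. **Estimator (DTSE).** From an initial estimate $\hat\eta_j^{(0)}$ and a positive definite matrix $\zeta_j^{(0)}$ compute, for $k\ge1$, $$\zeta_j^{(k|k-1)}=A_2\zeta_j^{(k-1)}A_2^\top+B_2Q_jB_2^\top,\quad K_j=\zeta_j^{(k|k-1)}C_{i,g}^\top\big(C_{i,g}\zeta_j^{(k|k-1)}C_{i,g}^\top+\hat\Upsilon_{i,g,j}\big)^{-1},\quad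 \zeta_j^{(k)}=(I-K_jC_{i,g})\zeta_j^{(k|k-1)},$$ $$\hat\eta_j^{(k)}=A_2\hat\eta_j^{(k-1)}+K_j\big(\theta_{i,g,j}-C_{i,g}A_2\hat\eta_j^{(k-1)}-(q_i-q_g)\big),$$ and let $e_j=\eta_j-\hat\eta_j$ be the estimation error; assume $\mathbf E\|e_j^{(0)}\|^2<\infty$. **Assumptions.** There are positive constants $\hat q,\check q,\hat r,\check r,\check c$ such that, for all $j$ and $k$, $\hat qI\le Q_j\le\check qI$, $\hat r\le\Upsilon_{i,g,j}\le\check r$ and, almost surely, $\hat r\le\hat\Upsilon_{i,g,j}\le\check r$ and $p_{i,g}p_{i,g}^\top\le\check cI$. **Theorem.** (1) Suppose that for every target $j$ there are constants $\hat\zeta_j,\check\zeta_j>0$ such that almost surely $$\hat\zeta_jI\le(\zeta_j^{(k)})^{-1}\le\check\zeta_jI\quad\text{for all }k>0. \tag{$*$}$$ Then the estimation errors are bounded in mean square: there is $\delta_1\ge0$ with $\mathbf E\|e_j^{(k)}\|^2\le\delta_1$ for all $j$ and all $k\ge0$. (2) The bound $(*)$ holds for target $j$ whenever its two drones use the encirclement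 controller $$u_i=-\tfrac2{t^2}F^\top(Fx_i-\hat s_j-\mathcal P-t\hat\nu_j)+\Gamma_i^{\rm aux}-\tfrac2tv_i,\qquad u_g=-\tfrac2{t^2}F^\top(Fx_g-\hat s_j+\mathcal P-t\hat\nu_j)+\Gamma_g^{\rm aux}-\tfrac2tv_g,$$ where $\hat\eta_j=(\hat s_j,\hat\nu_j)$, $\mathcal P^{(k)}=\rho[\sin(k\pi/\ell),\cos(k\pi/\ell)]^\top$ with $\rho>0$ and an integer $\ell\ge4$, and the additional (interaction and repulsive) pseudo-forces $\Gamma_i^{\rm aux},\Gamma_g^{\rm aux}$ are such that, for some positive integer $m_1$, almost surely for all $k\ge m_1$ the interval $[k-m_1,k]$ contains four consecutive instants at which both vanish. In particular, the conclusion of (1) holds if this is so for every target. -/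

import Mathlib

open MeasureTheory ProbabilityTheory Matrix
open scoped MatrixOrder NNReal

noncomputable section

namespace DTSE

/-- Index set of the target state: `Sum.inl` = planar position, `Sum.inr` = planar velocity. -/
abbrev SIdx := Fin 2 ⊕ Fin 2

/-- Euclidean norm of a coordinate vector. -/
def eNorm {n : Type*} [Fintype n] (v : n → ℝ) : ℝ := ‖WithLp.toLp 2 v‖

/-- Planar double-integrator transition matrix `[[I, t I], [0, I]]`. -/
def A₂ (t : ℝ) : Matrix SIdx SIdx ℝ := fromBlocks 1 (t • 1) 0 1

/-- Planar double-integrator input matrix `[t²/2 I; t I]`. -/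
def B₂ (t : ℝ) : Matrix SIdx (Fin 2) ℝ := fromRows ((t ^ 2 / 2) • 1) (t • 1)

/-- Projection of a position in space onto the ground plane. -/
def F : Matrix (Fin 2) (Fin 3) ℝ := !![1, 0, 0; 0, 1, 0]

/-- The output row `C = [-2 pᵀ Fᵀ, 0]` for the relative drone position `p`. -/
def outRow (p : Fin 3 → ℝ) : SIdx → ℝ := Sum.elim ((-2 : ℝ) • (F *ᵥ p)) 0

/-- Predicted variance `A₂ ζ A₂ᵀ + B₂ Q B₂ᵀ`. -/
def predVar (t : ℝ) (Q : Matrix (Fin 2) (Fin 2) ℝ) (ζ : Matrix SIdx SIdx ℝ) :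
    Matrix SIdx SIdx ℝ :=
  A₂ t * ζ * (A₂ t)ᵀ + B₂ t * Q * (B₂ t)ᵀ

/-- Estimator gain `P Cᵀ (C P Cᵀ + R)⁻¹`, a column since the output is scalar. -/
def gain (P : Matrix SIdx SIdx ℝ) (C : SIdx → ℝ) (R : ℝ) : SIdx → ℝ :=
  (C ⬝ᵥ (P *ᵥ C) + R)⁻¹ • (P *ᵥ C)

/-- The data of a run: `N` drones, `M` targets, all noises and initial values.
Superscripts `(k)` become an argument `k : ℕ`; `ω : Ω` is the sample point. -/
structure Scenario (Ω : Type*) (M N : ℕ) where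
  /-- sampling period -/
  t : ℝ
  /-- drone positions, velocities and controlled accelerations -/
  x : Fin N → ℕ → Ω → Fin 3 → ℝ
  v : Fin N → ℕ → Ω → Fin 3 → ℝ
  u : Fin N → ℕ → Ω → Fin 3 → ℝ
  /-- target states and stochastic target accelerations with their variance matrices -/
  η : Fin M → ℕ → Ω → SIdx → ℝ
  acc : Fin M → ℕ → Ω → Fin 2 → ℝ
  Q : Fin M → Matrix (Fin 2) (Fin 2) ℝ
  /-- distance noises (drone, target) and their variances -/
  ε : Fin N → Fin M → ℕ → Ω → ℝ
  q : Fin N → ℝ≥0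
  /-- the two drones that are assigned to a target -/
  i : Fin M → Fin N
  g : Fin M → Fin N
  /-- the estimate of the output noise variance that is fed to the estimator -/
  Υhat : Fin M → ℕ → Ω → ℝ
  /-- initial estimate and initial variance of the estimator -/
  ηhat₀ : Fin M → Ω → SIdx → ℝ
  ζ₀ : Fin M → Matrix SIdx SIdx ℝ

namespace Scenario

variable {Ω : Type*} {M N : ℕ} (S : Scenario Ω M N)

/-- Target position. -/
def s (j : Fin M) (k : ℕ) (ω : Ω) : Fin 2 → ℝ := fun a => S.η j k ω (Sum.inl a)

/-- True planar distance from drone `h` to target `j`. -/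
def dist (h : Fin N) (j : Fin M) (k : ℕ) (ω : Ω) : ℝ :=
  eNorm (F *ᵥ S.x h k ω - S.s j k ω)

/-- Measured distance. -/
def d (h : Fin N) (j : Fin M) (k : ℕ) (ω : Ω) : ℝ := S.dist h j k ω + S.ε h j k ω

/-- Relative position of the two drones that are assigned to target `j`. -/
def p (j : Fin M) (k : ℕ) (ω : Ω) : Fin 3 → ℝ := S.x (S.i j) k ω - S.x (S.g j) k ω

/-- Output row `C_{i,g}`. -/
def C (j : Fin M) (k : ℕ) (ω : Ω) : SIdx → ℝ := outRow (S.p j k ω)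

/-- The measurement `θ = d_i² - d_g² - x_iᵀFᵀF x_i + x_gᵀFᵀF x_g`. -/
def θ (j : Fin M) (k : ℕ) (ω : Ω) : ℝ :=
  S.d (S.i j) j k ω ^ 2 - S.d (S.g j) j k ω ^ 2
    - (F *ᵥ S.x (S.i j) k ω) ⬝ᵥ (F *ᵥ S.x (S.i j) k ω)
    + (F *ᵥ S.x (S.g j) k ω) ⬝ᵥ (F *ᵥ S.x (S.g j) k ω)

/-- The output noise `ε_i² - ε_g² + 2‖F x_i - s‖ ε_i - 2‖F x_g - s‖ ε_g`. -/
def εbar (j : Fin M) (k : ℕ) (ω : Ω) : ℝ :=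
  S.ε (S.i j) j k ω ^ 2 - S.ε (S.g j) j k ω ^ 2
    + 2 * S.dist (S.i j) j k ω * S.ε (S.i j) j k ω
    - 2 * S.dist (S.g j) j k ω * S.ε (S.g j) j k ω

/-- The Riccati variance `ζ_j` of the estimator. -/
def ζ (j : Fin M) : ℕ → Ω → Matrix SIdx SIdx ℝ
  | 0, _ => S.ζ₀ j
  | k + 1, ω =>
    (1 - vecMulVec (gain (predVar S.t (S.Q j) (ζ j k ω)) (S.C j (k + 1) ω)
          (S.Υhat j (k + 1) ω)) (S.C j (k + 1) ω))
      * predVar S.t (S.Q j) (ζ j k ω)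

/-- The gain used in the step from `k` to `k + 1`. -/
def K (j : Fin M) (k : ℕ) (ω : Ω) : SIdx → ℝ :=
  gain (predVar S.t (S.Q j) (S.ζ j k ω)) (S.C j (k + 1) ω) (S.Υhat j (k + 1) ω)

/-- The state estimate: prediction plus gain times innovation. -/
def ηhat (j : Fin M) : ℕ → Ω → SIdx → ℝ
  | 0, ω => S.ηhat₀ j ω
  | k + 1, ω =>
    A₂ S.t *ᵥ ηhat j k ω
      + (S.θ j (k + 1) ω
          - (S.C j (k + 1) ω ⬝ᵥ (A₂ S.t *ᵥ ηhat j k ω)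
              + (S.q (S.i j) : ℝ) - (S.q (S.g j) : ℝ))) • S.K j k ω

/-- The estimation error. -/
def e (j : Fin M) (k : ℕ) (ω : Ω) : SIdx → ℝ := S.η j k ω - S.ηhat j k ω

/-- Standing model: dynamics of drones and targets, laws of the noises, admissible initial
values. The noises of different instants need not be independent. -/
structure IsModel [MeasurableSpace Ω] (μ : Measure Ω) : Prop where
  t_pos : 0 < S.t
  drone_pos : ∀ h k ω, S.x h (k + 1) ω = S.x h k ω + S.t • S.v h k ω
    + (S.t ^ 2 / 2) • S.u h k ω
  drone_vel : ∀ h k ω, S.v h (k + 1) ω = S.v h k ω + S.t • S.u h k ω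
  target : ∀ j k ω, S.η j (k + 1) ω = A₂ S.t *ᵥ S.η j k ω + B₂ S.t *ᵥ S.acc j k ω
  meas_x : ∀ h k, Measurable (S.x h k)
  meas_η₀ : ∀ j, Measurable (S.η j 0)
  meas_ηhat₀ : ∀ j, Measurable (S.ηhat₀ j)
  meas_acc : ∀ j k, Measurable (S.acc j k)
  meas_ε : ∀ h j k, Measurable (S.ε h j k)
  meas_Υhat : ∀ j k, Measurable (S.Υhat j k)
  acc_law : ∀ j k,
    HasLaw (fun ω => WithLp.toLp 2 (S.acc j k ω)) (multivariateGaussian 0 (S.Q j)) μ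
  q_pos : ∀ h, 0 < S.q h
  ε_law : ∀ h j k, HasLaw (S.ε h j k) (gaussianReal 0 (S.q h)) μ
  ε_indep : ∀ j k, IndepFun (S.ε (S.i j) j k) (S.ε (S.g j) j k) μ
  ε_indep_state : ∀ j k,
    IndepFun (fun ω => (S.ε (S.i j) j k ω, S.ε (S.g j) j k ω))
      (fun ω => (S.x (S.i j) k ω, S.x (S.g j) k ω, S.η j k ω)) μ
  ζ₀_pos : ∀ j, (S.ζ₀ j).PosDef
  init_sq : ∀ j, MemLp (fun ω => WithLp.toLp 2 (S.e j 0 ω)) 2 μ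

/-- Two-sided bounds of the noise variances; the variance estimate obeys the bounds of the
variance it estimates. -/
structure NoiseBounds [MeasurableSpace Ω] (μ : Measure Ω) (qlo qhi rlo rhi : ℝ) : Prop where
  Q_lo : ∀ j, qlo • (1 : Matrix (Fin 2) (Fin 2) ℝ) ≤ S.Q j
  Q_hi : ∀ j, S.Q j ≤ qhi • (1 : Matrix (Fin 2) (Fin 2) ℝ)
  Υ_lo : ∀ j k, rlo ≤ Var[S.εbar j k; μ]
  Υ_hi : ∀ j k, Var[S.εbar j k; μ] ≤ rhi
  Υhat_lo : ∀ j, ∀ᵐ ω ∂μ, ∀ k, rlo ≤ S.Υhat j k ω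
  Υhat_hi : ∀ j, ∀ᵐ ω ∂μ, ∀ k, S.Υhat j k ω ≤ rhi

/-- Two drones of one group stay within bounded distance: `p pᵀ ≤ c I`. -/
def GroupBounded [MeasurableSpace Ω] (μ : Measure Ω) (c : ℝ) : Prop :=
  ∀ j, ∀ᵐ ω ∂μ, ∀ k,
    vecMulVec (S.p j k ω) (S.p j k ω) ≤ c • (1 : Matrix (Fin 3) (Fin 3) ℝ)

/-- Two-sided bound of the inverse Riccati variance of target `j` for all `k > 0`. -/
def VarianceBounded [MeasurableSpace Ω] (μ : Measure Ω) (j : Fin M) : Prop :=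
  ∃ zlo : ℝ, 0 < zlo ∧ ∃ zhi : ℝ, 0 < zhi ∧ ∀ᵐ ω ∂μ, ∀ k : ℕ, 0 < k →
    zlo • (1 : Matrix SIdx SIdx ℝ) ≤ (S.ζ j k ω)⁻¹ ∧
      (S.ζ j k ω)⁻¹ ≤ zhi • (1 : Matrix SIdx SIdx ℝ)

/-- The estimation errors of all targets are bounded in mean square. -/
def MeanSquareBounded [MeasurableSpace Ω] (μ : Measure Ω) : Prop :=
  ∃ δ₁ : ℝ, 0 ≤ δ₁ ∧ ∀ j k, Integrable (fun ω => eNorm (S.e j k ω) ^ 2) μ ∧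
    ∫ ω, eNorm (S.e j k ω) ^ 2 ∂μ ≤ δ₁

/-- Preset encirclement shape `ρ [sin(kπ/ℓ), cos(kπ/ℓ)]`. -/
def shape (ρ : ℝ) (ℓ k : ℕ) : Fin 2 → ℝ :=
  ρ • ![Real.sin (1 / (ℓ : ℝ) * k * Real.pi), Real.cos (1 / (ℓ : ℝ) * k * Real.pi)]

/-- Attractive pseudo-force on drone `h` towards target `j`, with preset relative position `r`:
`-(2/t²) Fᵀ (F x_h - ŝ_j - r - t ν̂_j)`. -/
def attract (h : Fin N) (j : Fin M) (r : Fin 2 → ℝ) (k : ℕ) (ω : Ω) : Fin 3 → ℝ :=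
  (-(2 / S.t ^ 2)) • (Fᵀ *ᵥ (F *ᵥ S.x h k ω - (fun a => S.ηhat j k ω (Sum.inl a)) - r
    - S.t • (fun a => S.ηhat j k ω (Sum.inr a))))

/-- The drones assigned to target `j` use the encirclement controller
`u = Γ_at + Γ_aux - (2/t) v`, on opposite sides of the target; `Γaux h` is the total mutual
interaction and repulsive pseudo-force on drone `h`. -/
def Encircles (ρ : ℝ) (ℓ : ℕ) (Γaux : Fin N → ℕ → Ω → Fin 3 → ℝ) (j : Fin M) : Prop :=
  ∀ k ω,
    S.u (S.i j) k ω = S.attract (S.i j) j (shape ρ ℓ k) k ω + Γaux (S.i j) k ω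
        - (2 / S.t) • S.v (S.i j) k ω ∧
    S.u (S.g j) k ω = S.attract (S.g j) j (-shape ρ ℓ k) k ω + Γaux (S.g j) k ω
        - (2 / S.t) • S.v (S.g j) k ω

/-- Every window `[k - m₁, k]` contains four consecutive instants at which the interaction and
repulsive pseudo-forces on both drones of target `j` vanish. -/
def QuietWindows [MeasurableSpace Ω] (μ : Measure Ω)
    (Γaux : Fin N → ℕ → Ω → Fin 3 → ℝ) (j : Fin M) : Prop :=
  ∃ m₁ : ℕ, 0 < m₁ ∧ ∀ᵐ ω ∂μ, ∀ k ≥ m₁, ∃ k₁, k ≤ k₁ + m₁ ∧ k₁ + 3 ≤ k ∧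
    ∀ n, k₁ ≤ n → n ≤ k₁ + 3 → Γaux (S.i j) n ω = 0 ∧ Γaux (S.g j) n ω = 0

end Scenario

end DTSE

end

/-! The filter is studied through its dual, backward form. For a test vector f at instant k+1 put κ
= K·f, g = f − κC and f' = A₂ᵀg. The weight V_k(f) = fᵀζ_k f obeys the energy balance V_{k+1}(f) =
V_k(f') + Q(B₂ᵀg) + Rκ², with R the supplied variance estimate (`quad_riccati_predVar`), and the
error obeys f·e_{k+1} = f'·e_k + (B₂ᵀg)·ω − κβ, with β the centred output noise
(`dotProduct_e_succ`).

Mean square bound. By Cauchy–Schwarz the squared increment of the tested error is at most the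
normalized noise size times the increment of the weight (`error_increment`). This is pathwise, so
neither independence in time nor independence of gain and noise matters. The process noise controls
the double integrator in two steps: |f|² ≤ L (V_{k+2}(f) − V_k(f'')), with f'' = (f')'
(`exists_two_step_bound`). With an upper bound z of ζ, the weight then shrinks by a fixed factor
over two backward steps, so (f·e_k)² ≤ v_k V_k(f), where v_{k+2} is l v_k plus noise and l < 1
(`dotProduct_e_sq_le_majorant`). The choice f = e_k gives |e_k|² ≤ z v_k, and the mean of v_k stays
bounded because ω has a fixed law and β has second moment Υ.

Bounds of ζ. From below, the same controllability estimate suffices, with V_k ≥ 0 dropped. From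
above, the vectors ζ_k f_k met while going backward form a trajectory of the target dynamics whose
inputs and outputs are paid for by the decrease of the weight (`exists_backward_step`). A quiet
instant puts the drones exactly opposite each other, so C becomes −4ρ times a unit vector that turns
by π/ℓ per step (`C_succ_of_quiet`). Four such outputs determine the state
(`state_bound_of_rotating_outputs`), whence ζ² ≤ Dζ, that is ζ ≤ D. After a quiet group the bound
worsens by a fixed affine map per step, for at most m₁ steps. -/

open MeasureTheory ProbabilityTheory Matrix
open scoped MatrixOrder NNReal

noncomputable section

namespace DTSE

/-! ### Order bounds of matrices expressed by quadratic forms. -/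

section LinearAlgebra

variable {n : Type*} [Fintype n]

/-- The quadratic form of a matrix. -/
def quad (Z : Matrix n n ℝ) (f : n → ℝ) : ℝ := f ⬝ᵥ (Z *ᵥ f)

lemma quad_nonneg {Z : Matrix n n ℝ} (hZ : Z.PosSemidef) (f : n → ℝ) : 0 ≤ quad Z f := by
  simpa [quad] using hZ.dotProduct_mulVec_nonneg f

lemma dotProduct_self_nonneg_real (f : n → ℝ) : 0 ≤ f ⬝ᵥ f :=
  Finset.sum_nonneg fun i _ => mul_self_nonneg (f i)

lemma dotProduct_mulVec_symm {Z : Matrix n n ℝ} (hZ : Zᵀ = Z) (f g : n → ℝ) :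
    f ⬝ᵥ (Z *ᵥ g) = g ⬝ᵥ (Z *ᵥ f) := by
  rw [dotProduct_mulVec, ← mulVec_transpose, hZ, dotProduct_comm]

lemma posSemidef_transpose {n : Type*} {Z : Matrix n n ℝ} (hZ : Z.PosSemidef) : Zᵀ = Z := by
  simpa [IsHermitian, conjTranspose_eq_transpose_of_trivial] using hZ.isHermitian

lemma posSemidef_of_quad {Z : Matrix n n ℝ} (hs : Zᵀ = Z) (h : ∀ f, 0 ≤ quad Z f) :
    Z.PosSemidef := by
  refine PosSemidef.of_dotProduct_mulVec_nonneg ?_ fun f => ?_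
  · simpa [IsHermitian, conjTranspose_eq_transpose_of_trivial] using hs
  · simpa [quad] using h f

lemma posDef_of_quad {Z : Matrix n n ℝ} (hs : Zᵀ = Z) (h : ∀ f, f ≠ 0 → 0 < quad Z f) :
    Z.PosDef := by
  refine PosDef.of_dotProduct_mulVec_pos ?_ fun f hf => ?_
  · simpa [IsHermitian, conjTranspose_eq_transpose_of_trivial] using hs
  · simpa [quad] using h f hf

lemma quad_pos {Z : Matrix n n ℝ} (hZ : Z.PosDef) {f : n → ℝ} (hf : f ≠ 0) : 0 < quad Z f := by
  simpa [quad] using hZ.dotProduct_mulVec_pos hf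

lemma quad_sub_smul_one [DecidableEq n] (Z : Matrix n n ℝ) (a : ℝ) (f : n → ℝ) :
    quad (Z - a • 1) f = quad Z f - a * (f ⬝ᵥ f) := by
  simp [quad, sub_mulVec, smul_mulVec, dotProduct_sub, dotProduct_smul]

lemma quad_smul_one_sub [DecidableEq n] (Z : Matrix n n ℝ) (a : ℝ) (f : n → ℝ) :
    quad (a • 1 - Z) f = a * (f ⬝ᵥ f) - quad Z f := by
  simp [quad, sub_mulVec, smul_mulVec, dotProduct_sub, dotProduct_smul]

lemma le_quad_of_smul_one_le [DecidableEq n] {Z : Matrix n n ℝ} {a : ℝ}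
    (h : a • (1 : Matrix n n ℝ) ≤ Z) (f : n → ℝ) : a * (f ⬝ᵥ f) ≤ quad Z f := by
  have := quad_nonneg (Matrix.le_iff.1 h) f
  rw [quad_sub_smul_one] at this
  linarith

lemma quad_le_of_le_smul_one [DecidableEq n] {Z : Matrix n n ℝ} {a : ℝ}
    (h : Z ≤ a • (1 : Matrix n n ℝ)) (f : n → ℝ) : quad Z f ≤ a * (f ⬝ᵥ f) := by
  have := quad_nonneg (Matrix.le_iff.1 h) f
  rw [quad_smul_one_sub] at this
  linarith

lemma smul_one_le_of_le_quad [DecidableEq n] {Z : Matrix n n ℝ} (hs : Zᵀ = Z) {a : ℝ}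
    (h : ∀ f, a * (f ⬝ᵥ f) ≤ quad Z f) : a • (1 : Matrix n n ℝ) ≤ Z := by
  refine Matrix.le_iff.2 (posSemidef_of_quad (by simp [hs]) fun f => ?_)
  rw [quad_sub_smul_one]
  linarith [h f]

lemma le_smul_one_of_quad_le [DecidableEq n] {Z : Matrix n n ℝ} (hs : Zᵀ = Z) {a : ℝ}
    (h : ∀ f, quad Z f ≤ a * (f ⬝ᵥ f)) : Z ≤ a • (1 : Matrix n n ℝ) := by
  refine Matrix.le_iff.2 (posSemidef_of_quad (by simp [hs]) fun f => ?_)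
  rw [quad_smul_one_sub]
  linarith [h f]

lemma transpose_eq_of_smul_one_le {n : Type*} [DecidableEq n] {Z : Matrix n n ℝ} {a : ℝ}
    (h : a • (1 : Matrix n n ℝ) ≤ Z) : Zᵀ = Z := by
  have := posSemidef_transpose (Matrix.le_iff.1 h)
  simpa using this

/-- A positive semidefinite matrix bounded by `c` satisfies `Z² ≤ c Z`. -/
lemma mulVec_sq_le {Z : Matrix n n ℝ} (hZ : Z.PosSemidef) {c : ℝ} (hc : 0 < c)
    (h : ∀ f, quad Z f ≤ c * (f ⬝ᵥ f)) (f : n → ℝ) :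
    (Z *ᵥ f) ⬝ᵥ (Z *ᵥ f) ≤ c * quad Z f := by
  -- In operator form: Z(c − Z)² ≥ 0 together with Z³ ≤ cZ² leaves c²Z − cZ² ≥ 0.
  have h0 := quad_nonneg hZ (c • f - Z *ᵥ f)
  have h1 := h (Z *ᵥ f)
  have h2 : quad Z (c • f - Z *ᵥ f)
      = c ^ 2 * quad Z f - 2 * c * ((Z *ᵥ f) ⬝ᵥ (Z *ᵥ f)) + quad Z (Z *ᵥ f) := by
    have := dotProduct_mulVec_symm (posSemidef_transpose hZ) f (Z *ᵥ f)
    simp only [quad, mulVec_sub, mulVec_smul, dotProduct_sub, sub_dotProduct, smul_dotProduct,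
      dotProduct_smul, smul_eq_mul, this]
    ring
  rw [h2] at h0
  have : 0 ≤ c * (c * quad Z f - (Z *ᵥ f) ⬝ᵥ (Z *ᵥ f)) := by nlinarith
  linarith [nonneg_of_mul_nonneg_right this hc]

/-- Converse of `mulVec_sq_le`, from |cf − Zf|² ≥ 0. The form Z² ≤ cZ of an upper bound suits the
observability argument, which estimates the vector Zf by the weight of f. -/
lemma quad_le_of_mulVec_sq_le {Z : Matrix n n ℝ} {c : ℝ} (hc : 0 < c) (f : n → ℝ)
    (h : (Z *ᵥ f) ⬝ᵥ (Z *ᵥ f) ≤ c * quad Z f) : quad Z f ≤ c * (f ⬝ᵥ f) := by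
  have h0 := dotProduct_self_nonneg_real (c • f - Z *ᵥ f)
  have h2 : (c • f - Z *ᵥ f) ⬝ᵥ (c • f - Z *ᵥ f)
      = c ^ 2 * (f ⬝ᵥ f) - 2 * c * quad Z f + (Z *ᵥ f) ⬝ᵥ (Z *ᵥ f) := by
    simp only [quad, dotProduct_sub, sub_dotProduct, smul_dotProduct, dotProduct_smul,
      smul_eq_mul, dotProduct_comm (Z *ᵥ f) f]
    ring
  rw [h2] at h0
  have : 0 ≤ c * (c * (f ⬝ᵥ f) - quad Z f) := by nlinarith
  linarith [nonneg_of_mul_nonneg_right this hc]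

lemma quad_inv_mulVec [DecidableEq n] {Z : Matrix n n ℝ} (hZ : Z.PosDef) (f : n → ℝ) :
    quad Z (Z⁻¹ *ᵥ f) = quad Z⁻¹ f := by
  have : Z *ᵥ (Z⁻¹ *ᵥ f) = f := by
    rw [mulVec_mulVec, mul_nonsing_inv _ ((isUnit_iff_isUnit_det _).1 hZ.isUnit), one_mulVec]
  rw [quad, this, quad, dotProduct_comm]

/-- Substituting Z⁻¹f for f turns the hypothesis into (Z⁻¹)² ≤ cZ⁻¹. -/
lemma inv_le_of_le_quad [DecidableEq n] {Z : Matrix n n ℝ} (hZ : Z.PosDef) {c : ℝ} (hc : 0 < c)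
    (h : ∀ f, f ⬝ᵥ f ≤ c * quad Z f) : Z⁻¹ ≤ c • (1 : Matrix n n ℝ) := by
  refine le_smul_one_of_quad_le (posSemidef_transpose hZ.inv.posSemidef) fun f => ?_
  refine quad_le_of_mulVec_sq_le hc f ?_
  rw [← quad_inv_mulVec hZ]
  exact h _

lemma le_inv_of_mulVec_sq_le [DecidableEq n] {Z : Matrix n n ℝ} (hZ : Z.PosDef) {c : ℝ}
    (hc : 0 < c) (h : ∀ f, (Z *ᵥ f) ⬝ᵥ (Z *ᵥ f) ≤ c * quad Z f) :
    c⁻¹ • (1 : Matrix n n ℝ) ≤ Z⁻¹ := by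
  refine smul_one_le_of_le_quad (posSemidef_transpose hZ.inv.posSemidef) fun f => ?_
  have h1 := h (Z⁻¹ *ᵥ f)
  rw [quad_inv_mulVec hZ, mulVec_mulVec,
    mul_nonsing_inv _ ((isUnit_iff_isUnit_det _).1 hZ.isUnit), one_mulVec] at h1
  rw [inv_mul_le_iff₀ hc]
  exact h1

lemma quad_le_of_le_inv [DecidableEq n] {Z : Matrix n n ℝ} (hZ : Z.PosDef) {a : ℝ}
    (ha : 0 < a) (h : a • (1 : Matrix n n ℝ) ≤ Z⁻¹) (f : n → ℝ) :
    quad Z f ≤ a⁻¹ * (f ⬝ᵥ f) := by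
  refine quad_le_of_mulVec_sq_le (inv_pos.2 ha) f ?_
  have h1 := le_quad_of_smul_one_le h (Z *ᵥ f)
  have h2 : quad Z⁻¹ (Z *ᵥ f) = quad Z f := by
    rw [quad, mulVec_mulVec, nonsing_inv_mul _ ((isUnit_iff_isUnit_det _).1 hZ.isUnit),
      one_mulVec, quad, dotProduct_comm]
  rw [h2] at h1
  rwa [le_inv_mul_iff₀ ha]

lemma exists_quad_le (Z : Matrix n n ℝ) :
    ∃ c : ℝ, 0 < c ∧ ∀ f, quad Z f ≤ c * (f ⬝ᵥ f) := by
  refine ⟨1 + ∑ i, ∑ j, |Z i j|, by positivity, fun f => ?_⟩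
  have h0 := dotProduct_self_nonneg_real f
  have hi : ∀ i, f i * f i ≤ f ⬝ᵥ f := fun i =>
    Finset.single_le_sum (f := fun i => f i * f i) (fun j _ => mul_self_nonneg (f j))
      (Finset.mem_univ i)
  have hij : ∀ i j, f i * (Z i j * f j) ≤ |Z i j| * (f ⬝ᵥ f) := fun i j => by
    have h1 : |f i * f j| ≤ f ⬝ᵥ f := by
      rw [abs_le]
      constructor <;> nlinarith [hi i, hi j, sq_nonneg (f i + f j), sq_nonneg (f i - f j)]
    calc f i * (Z i j * f j) = Z i j * (f i * f j) := by ring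
      _ ≤ |Z i j * (f i * f j)| := le_abs_self _
      _ = |Z i j| * |f i * f j| := abs_mul _ _
      _ ≤ _ := by gcongr
  calc quad Z f = ∑ i, ∑ j, f i * (Z i j * f j) := by
        simp [quad, dotProduct, mulVec, Finset.mul_sum]
    _ ≤ ∑ i, ∑ j, |Z i j| * (f ⬝ᵥ f) :=
        Finset.sum_le_sum fun i _ => Finset.sum_le_sum fun j _ => hij i j
    _ = (∑ i, ∑ j, |Z i j|) * (f ⬝ᵥ f) := by simp [Finset.sum_mul]
    _ ≤ _ := by nlinarith

/-- An entrywise upper bound of Z⁻¹, tested at Zf, replaces compactness of the sphere or a smallest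
eigenvalue. -/
lemma exists_le_quad [DecidableEq n] {Z : Matrix n n ℝ} (hZ : Z.PosDef) :
    ∃ c : ℝ, 0 < c ∧ ∀ f, f ⬝ᵥ f ≤ c * quad Z f := by
  obtain ⟨c, hc, h⟩ := exists_quad_le Z⁻¹
  refine ⟨c, hc, fun f => ?_⟩
  have h1 := mulVec_sq_le hZ.inv.posSemidef hc h (Z *ᵥ f)
  rwa [quad, mulVec_mulVec, nonsing_inv_mul _ ((isUnit_iff_isUnit_det _).1 hZ.isUnit),
    one_mulVec, dotProduct_comm (Z *ᵥ f) f] at h1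

end LinearAlgebra

/-! ### The energy balance of the Riccati update in dual variables. -/

section Riccati

/-- The variance update `(1 - K C) P`. -/
def riccati (P : Matrix SIdx SIdx ℝ) (C : SIdx → ℝ) (R : ℝ) : Matrix SIdx SIdx ℝ :=
  (1 - vecMulVec (gain P C R) C) * P

/-- The dual of the a posteriori update of the error: `f - (K ⬝ f) C`. -/
def dualUpdate (P : Matrix SIdx SIdx ℝ) (C : SIdx → ℝ) (R : ℝ) (f : SIdx → ℝ) : SIdx → ℝ :=
  f - (gain P C R ⬝ᵥ f) • C

variable {P : Matrix SIdx SIdx ℝ} {C : SIdx → ℝ} {R : ℝ}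

lemma riccati_mulVec (hP : P.PosSemidef) (f : SIdx → ℝ) :
    riccati P C R *ᵥ f = P *ᵥ dualUpdate P C R f := by
  have h1 : C ⬝ᵥ (P *ᵥ f) = (P *ᵥ C) ⬝ᵥ f := by
    rw [dotProduct_mulVec_symm (posSemidef_transpose hP), dotProduct_comm]
  rw [riccati, ← mulVec_mulVec, sub_mulVec, one_mulVec, vecMulVec_mulVec, dualUpdate, mulVec_sub,
    mulVec_smul]
  congr 1
  ext i
  simp [gain, h1]
  ring

lemma dotProduct_riccati_mulVec (hP : P.PosSemidef) (hR : 0 < R) (f : SIdx → ℝ) :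
    C ⬝ᵥ (riccati P C R *ᵥ f) = R * (gain P C R ⬝ᵥ f) := by
  have h1 : C ⬝ᵥ (P *ᵥ f) = (P *ᵥ C) ⬝ᵥ f := by
    rw [dotProduct_mulVec_symm (posSemidef_transpose hP), dotProduct_comm]
  have h2 := quad_nonneg hP C
  rw [quad] at h2
  have h3 : C ⬝ᵥ (P *ᵥ C) + R ≠ 0 := by positivity
  rw [riccati_mulVec hP, dualUpdate, mulVec_sub, mulVec_smul, dotProduct_sub, dotProduct_smul, h1]
  simp only [gain, smul_dotProduct, smul_eq_mul]
  field_simp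
  ring

/-- Split f = g + κC on one side only: g pairs with Pg, and κC pairs with the updated variance to
give Rκ². This is the Joseph form of the update. -/
lemma quad_riccati (hP : P.PosSemidef) (hR : 0 < R) (f : SIdx → ℝ) :
    quad (riccati P C R) f
      = quad P (dualUpdate P C R f) + R * (gain P C R ⬝ᵥ f) ^ 2 := by
  have h1 := dotProduct_riccati_mulVec (C := C) hP hR f
  have h2 : f = dualUpdate P C R f + (gain P C R ⬝ᵥ f) • C := by simp [dualUpdate]
  rw [quad]
  nth_rewrite 1 [h2]
  rw [add_dotProduct, smul_dotProduct, h1, riccati_mulVec hP, quad, smul_eq_mul]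
  ring

lemma riccati_transpose (hP : P.PosSemidef) : (riccati P C R)ᵀ = riccati P C R := by
  have hs := posSemidef_transpose hP
  have h : riccati P C R
      = P - (C ⬝ᵥ (P *ᵥ C) + R)⁻¹ • vecMulVec (P *ᵥ C) (P *ᵥ C) := by
    rw [riccati, sub_mul, one_mul, vecMulVec_mul, gain, smul_vecMulVec, ← mulVec_transpose, hs]
  rw [h, transpose_sub, transpose_smul, transpose_vecMulVec, hs]

/-- If the dual vector g vanishes, then f = κC with κ ≠ 0 and the term Rκ² is positive; otherwise P
is positive on g. -/
lemma riccati_posDef (hP : P.PosDef) (hR : 0 < R) : (riccati P C R).PosDef := by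
  refine posDef_of_quad (riccati_transpose hP.posSemidef) fun f hf => ?_
  rw [quad_riccati hP.posSemidef hR]
  by_cases hg : dualUpdate P C R f = 0
  · have hκ : gain P C R ⬝ᵥ f ≠ 0 := by
      intro h0
      apply hf
      simpa [dualUpdate, h0] using hg
    have := quad_nonneg hP.posSemidef (dualUpdate P C R f)
    positivity
  · have := quad_pos hP hg
    positivity

variable {t : ℝ} {Q : Matrix (Fin 2) (Fin 2) ℝ} {Z : Matrix SIdx SIdx ℝ}

lemma predVar_mulVec (g : SIdx → ℝ) :
    predVar t Q Z *ᵥ g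
      = A₂ t *ᵥ (Z *ᵥ ((A₂ t)ᵀ *ᵥ g)) + B₂ t *ᵥ (Q *ᵥ ((B₂ t)ᵀ *ᵥ g)) := by
  simp [predVar, add_mulVec, mulVec_mulVec, Matrix.mul_assoc]

lemma quad_predVar (g : SIdx → ℝ) :
    quad (predVar t Q Z) g = quad Z ((A₂ t)ᵀ *ᵥ g) + quad Q ((B₂ t)ᵀ *ᵥ g) := by
  rw [quad, predVar_mulVec, dotProduct_add, dotProduct_mulVec, dotProduct_mulVec g (B₂ t),
    ← mulVec_transpose, ← mulVec_transpose]
  rfl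

lemma A₂_transpose_mulVec (g : SIdx → ℝ) :
    (A₂ t)ᵀ *ᵥ g = Sum.elim (fun a => g (.inl a)) (fun a => t * g (.inl a) + g (.inr a)) := by
  ext a
  rcases a with a | a <;>
    simp [A₂, fromBlocks_transpose, fromBlocks_mulVec, Function.comp_def, smul_mulVec]

lemma B₂_transpose_mulVec (g : SIdx → ℝ) :
    (B₂ t)ᵀ *ᵥ g = fun a => t ^ 2 / 2 * g (.inl a) + t * g (.inr a) := by
  ext a
  simp [B₂, transpose_fromRows, fromCols_mulVec, Function.comp_def, smul_mulVec]

lemma A₂_mulVec (x : SIdx → ℝ) :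
    A₂ t *ᵥ x = Sum.elim (fun a => x (.inl a) + t * x (.inr a)) (fun a => x (.inr a)) := by
  ext a
  rcases a with a | a <;>
    simp [A₂, fromBlocks_mulVec, Function.comp_def, smul_mulVec]

lemma B₂_mulVec (w : Fin 2 → ℝ) :
    B₂ t *ᵥ w = Sum.elim (fun a => t ^ 2 / 2 * w a) (fun a => t * w a) := by
  ext a
  rcases a with a | a <;> simp [B₂, fromRows_mulVec, smul_mulVec]

lemma predVar_posDef (hZ : Z.PosDef) (hQ : Q.PosSemidef) : (predVar t Q Z).PosDef := by
  refine posDef_of_quad ?_ fun g hg => ?_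
  · simp [predVar, posSemidef_transpose hZ.posSemidef, posSemidef_transpose hQ,
      Matrix.mul_assoc]
  · rw [quad_predVar]
    refine add_pos_of_pos_of_nonneg (quad_pos hZ fun h => hg ?_) (quad_nonneg hQ _)
    rw [A₂_transpose_mulVec] at h
    have h1 : ∀ a, g (.inl a) = 0 := fun a => by simpa using congrFun h (.inl a)
    ext a
    rcases a with a | a
    · exact h1 a
    · simpa [h1] using congrFun h (.inr a)

end Riccati

section OneStep

variable {t : ℝ} {Q : Matrix (Fin 2) (Fin 2) ℝ} {Z : Matrix SIdx SIdx ℝ} {C : SIdx → ℝ} {R : ℝ}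

lemma quad_riccati_predVar (hZ : Z.PosDef) (hQ : Q.PosSemidef) (hR : 0 < R) (f : SIdx → ℝ) :
    quad (riccati (predVar t Q Z) C R) f
      = quad Z ((A₂ t)ᵀ *ᵥ dualUpdate (predVar t Q Z) C R f)
        + quad Q ((B₂ t)ᵀ *ᵥ dualUpdate (predVar t Q Z) C R f)
        + R * (gain (predVar t Q Z) C R ⬝ᵥ f) ^ 2 := by
  rw [quad_riccati (predVar_posDef hZ hQ).posSemidef hR, quad_predVar]

/-- One backward step: the smoothed state `Z f` follows the target dynamics, and the
increase of the quadratic form controls both the driving input and the output. -/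
lemma exists_backward_step (hZ : Z.PosDef) (hQ : Q.PosSemidef) {rhi qhi : ℝ} (hqhi : 0 < qhi)
    (hQhi : ∀ b, quad Q b ≤ qhi * (b ⬝ᵥ b)) (hR : 0 < R) (hRhi : R ≤ rhi) (f : SIdx → ℝ) :
    ∃ (f₀ : SIdx → ℝ) (w : Fin 2 → ℝ),
      riccati (predVar t Q Z) C R *ᵥ f = A₂ t *ᵥ (Z *ᵥ f₀) + B₂ t *ᵥ w ∧
      quad Z f₀ ≤ quad (riccati (predVar t Q Z) C R) f ∧
      w ⬝ᵥ w ≤ qhi * (quad (riccati (predVar t Q Z) C R) f - quad Z f₀) ∧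
      (C ⬝ᵥ (riccati (predVar t Q Z) C R *ᵥ f)) ^ 2
        ≤ rhi * (quad (riccati (predVar t Q Z) C R) f - quad Z f₀) := by
  have hP := (predVar_posDef (t := t) hZ hQ).posSemidef
  set g := dualUpdate (predVar t Q Z) C R f with hg
  set κ := gain (predVar t Q Z) C R ⬝ᵥ f with hκ
  have h1 : quad (riccati (predVar t Q Z) C R) f - quad Z ((A₂ t)ᵀ *ᵥ g)
      = quad Q ((B₂ t)ᵀ *ᵥ g) + R * κ ^ 2 := by
    rw [quad_riccati_predVar hZ hQ hR]
    ring
  have h2 := quad_nonneg hQ ((B₂ t)ᵀ *ᵥ g)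
  have h3 : 0 ≤ R * κ ^ 2 := by positivity
  -- Both witnesses are read off from Pg = A₂Z(A₂ᵀg) + B₂Q(B₂ᵀg). The output equals Rκ, and (Rκ)² =
  -- R·Rκ².
  refine ⟨(A₂ t)ᵀ *ᵥ g, Q *ᵥ ((B₂ t)ᵀ *ᵥ g), ?_, ?_, ?_, ?_⟩
  · rw [riccati_mulVec hP, predVar_mulVec]
  · linarith
  · rw [h1]
    refine (mulVec_sq_le hQ hqhi hQhi _).trans ?_
    gcongr
    linarith
  · rw [h1, dotProduct_riccati_mulVec hP hR, ← hκ]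
    calc (R * κ) ^ 2 = R * (R * κ ^ 2) := by ring
      _ ≤ rhi * (quad Q ((B₂ t)ᵀ *ᵥ g) + R * κ ^ 2) := by
        refine mul_le_mul hRhi (by linarith) h3 (by linarith)

lemma dotProduct_SIdx (x y : SIdx → ℝ) :
    x ⬝ᵥ y = x (.inl 0) * y (.inl 0) + x (.inl 1) * y (.inl 1)
      + (x (.inr 0) * y (.inr 0) + x (.inr 1) * y (.inr 1)) := by
  simp [dotProduct]

/-- The bound `Z² ≤ c Z` deteriorates at most affinely in one step. -/
lemma mulVec_sq_le_step (hZ : Z.PosDef) (hQ : Q.PosSemidef) {qhi : ℝ} (hqhi : 0 < qhi)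
    (hQhi : ∀ b, quad Q b ≤ qhi * (b ⬝ᵥ b)) (hR : 0 < R) {c : ℝ} (hc : 0 ≤ c)
    (h : ∀ f, (Z *ᵥ f) ⬝ᵥ (Z *ᵥ f) ≤ c * quad Z f) (f : SIdx → ℝ) :
    (riccati (predVar t Q Z) C R *ᵥ f) ⬝ᵥ (riccati (predVar t Q Z) C R *ᵥ f)
      ≤ ((6 + 4 * t ^ 2) * c + (t ^ 4 + 2 * t ^ 2) * qhi)
        * quad (riccati (predVar t Q Z) C R) f := by
  obtain ⟨f₀, w, hx, hV, hw, -⟩ :=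
    exists_backward_step (t := t) (C := C) hZ hQ hqhi hQhi hR le_rfl f
  rw [hx]
  set V := quad (riccati (predVar t Q Z) C R) f
  have h0 := quad_nonneg hZ.posSemidef f₀
  have h1 : (Z *ᵥ f₀) ⬝ᵥ (Z *ᵥ f₀) ≤ c * V := (h f₀).trans (by gcongr)
  have h2 : w ⬝ᵥ w ≤ qhi * V := hw.trans (by gcongr; linarith)
  generalize Z *ᵥ f₀ = x at h1
  have h3 : (A₂ t *ᵥ x + B₂ t *ᵥ w) ⬝ᵥ (A₂ t *ᵥ x + B₂ t *ᵥ w)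
      ≤ (6 + 4 * t ^ 2) * (x ⬝ᵥ x) + (t ^ 4 + 2 * t ^ 2) * (w ⬝ᵥ w) := by
    have key : ∀ p v b : ℝ, (p + t * v + t ^ 2 / 2 * b) ^ 2 + (v + t * b) ^ 2
        ≤ (6 + 4 * t ^ 2) * (p ^ 2 + v ^ 2) + (t ^ 4 + 2 * t ^ 2) * b ^ 2 := by
      intro p v b
      have e1 : (p + t * v + t ^ 2 / 2 * b) ^ 2 ≤ 2 * (p + t * v) ^ 2 + 2 * (t ^ 2 / 2 * b) ^ 2 := by
        nlinarith [sq_nonneg (p + t * v - t ^ 2 / 2 * b)]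
      have e2 : (p + t * v) ^ 2 ≤ 2 * p ^ 2 + 2 * (t * v) ^ 2 := by
        nlinarith [sq_nonneg (p - t * v)]
      have e3 : (v + t * b) ^ 2 ≤ 2 * v ^ 2 + 2 * (t * b) ^ 2 := by
        nlinarith [sq_nonneg (v - t * b)]
      nlinarith [sq_nonneg p, sq_nonneg v, sq_nonneg (t * p), sq_nonneg (t ^ 2 * b)]
    have k0 := key (x (.inl 0)) (x (.inr 0)) (w 0)
    have k1 := key (x (.inl 1)) (x (.inr 1)) (w 1)
    rw [A₂_mulVec, B₂_mulVec, dotProduct_SIdx, dotProduct_SIdx x x]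
    simp only [Pi.add_apply, Sum.elim_inl, Sum.elim_inr, dotProduct, Fin.sum_univ_two]
    linarith
  calc _ ≤ _ := h3
    _ ≤ (6 + 4 * t ^ 2) * (c * V) + (t ^ 4 + 2 * t ^ 2) * (qhi * V) := by gcongr
    _ = _ := by ring

end OneStep

/-! ### Controllability from the process noise: lower bounds of the variance. -/

section Controllability

/-- One planar axis of the backward recursion: (gp, gv) is the last dual vector, and b₁, b₂ are the
tested inputs of the two steps. Since b₁ − b₂ = t²gp − t²κ₁c₁/2, the inputs and κ₁ determine gp,
then gv; adding κ₂c₂ recovers the test vector. -/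
lemma two_step_coordinate {t cc : ℝ} (ht : 0 < t) (hcc : 0 ≤ cc) {gp gv κ₁ κ₂ c₁ c₂ : ℝ}
    (h₁ : c₁ ^ 2 ≤ cc) (h₂ : c₂ ^ 2 ≤ cc) :
    (gp + κ₂ * c₂) ^ 2 + gv ^ 2 ≤
      ((2 + t ^ 2 / 2) * (3 * (1 / t ^ 4 + cc)) + 2 * cc + 2 / t ^ 2)
        * ((t ^ 2 / 2 * (gp - κ₁ * c₁) + t * (t * gp + gv)) ^ 2
            + (t ^ 2 / 2 * gp + t * gv) ^ 2 + κ₁ ^ 2 + κ₂ ^ 2) := by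
  set b₁ := t ^ 2 / 2 * (gp - κ₁ * c₁) + t * (t * gp + gv) with hb₁
  set b₂ := t ^ 2 / 2 * gp + t * gv with hb₂
  have e1 : gp = b₁ / t ^ 2 - b₂ / t ^ 2 + κ₁ * c₁ / 2 := by
    rw [hb₁, hb₂]
    field_simp
    ring
  have e2 : gv = b₂ / t - t / 2 * gp := by
    rw [hb₂]
    field_simp
    ring
  clear_value b₁ b₂
  have hG : gp ^ 2 ≤ 3 * (1 / t ^ 4 + cc) * (b₁ ^ 2 + b₂ ^ 2 + κ₁ ^ 2 + κ₂ ^ 2) := by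
    have a1 : gp ^ 2 ≤ 3 * ((b₁ / t ^ 2) ^ 2 + (b₂ / t ^ 2) ^ 2 + (κ₁ * c₁ / 2) ^ 2) := by
      rw [e1]
      nlinarith [sq_nonneg (b₁ / t ^ 2 + b₂ / t ^ 2), sq_nonneg (b₁ / t ^ 2 - κ₁ * c₁ / 2),
        sq_nonneg (b₂ / t ^ 2 + κ₁ * c₁ / 2)]
    have a2 : (b₁ / t ^ 2) ^ 2 = 1 / t ^ 4 * b₁ ^ 2 := by field_simp
    have a3 : (b₂ / t ^ 2) ^ 2 = 1 / t ^ 4 * b₂ ^ 2 := by field_simp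
    have a4 : (κ₁ * c₁ / 2) ^ 2 ≤ cc * κ₁ ^ 2 := by nlinarith [sq_nonneg κ₁]
    have a5 : 0 ≤ 1 / t ^ 4 := by positivity
    rw [a2, a3] at a1
    nlinarith [mul_nonneg a5 (sq_nonneg κ₁), mul_nonneg a5 (sq_nonneg κ₂),
      mul_nonneg hcc (sq_nonneg b₁), mul_nonneg hcc (sq_nonneg b₂), mul_nonneg hcc (sq_nonneg κ₂)]
  set H := b₁ ^ 2 + b₂ ^ 2 + κ₁ ^ 2 + κ₂ ^ 2 with hH
  have hf : (gp + κ₂ * c₂) ^ 2 ≤ 2 * gp ^ 2 + 2 * cc * H := by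
    have a1 : (gp + κ₂ * c₂) ^ 2 ≤ 2 * gp ^ 2 + 2 * (κ₂ * c₂) ^ 2 := by
      nlinarith [sq_nonneg (gp - κ₂ * c₂)]
    have a2 : (κ₂ * c₂) ^ 2 ≤ cc * κ₂ ^ 2 := by nlinarith [sq_nonneg κ₂]
    have a3 : cc * κ₂ ^ 2 ≤ cc * H := by
      gcongr
      rw [hH]
      nlinarith [sq_nonneg b₁, sq_nonneg b₂, sq_nonneg κ₁]
    linarith
  have hv : gv ^ 2 ≤ 2 / t ^ 2 * H + t ^ 2 / 2 * gp ^ 2 := by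
    have a1 : gv ^ 2 ≤ 2 * (b₂ / t) ^ 2 + 2 * (t / 2 * gp) ^ 2 := by
      rw [e2]
      nlinarith [sq_nonneg (b₂ / t + t / 2 * gp)]
    have a2 : 2 * (b₂ / t) ^ 2 = 2 / t ^ 2 * b₂ ^ 2 := by field_simp
    have a3 : 2 / t ^ 2 * b₂ ^ 2 ≤ 2 / t ^ 2 * H := by
      gcongr
      rw [hH]
      nlinarith [sq_nonneg b₁, sq_nonneg κ₂, sq_nonneg κ₁]
    nlinarith
  have hm : (2 + t ^ 2 / 2) * gp ^ 2 ≤ (2 + t ^ 2 / 2) * (3 * (1 / t ^ 4 + cc) * H) := by gcongr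
  linarith

/-- Two steps make the pair (dynamics, process noise) uniformly controllable. -/
lemma exists_two_step_bound {t qlo rlo cc : ℝ} (ht : 0 < t) (hqlo : 0 < qlo) (hrlo : 0 < rlo)
    (hcc : 0 ≤ cc) :
    ∃ D : ℝ, 0 < D ∧ ∀ (Q : Matrix (Fin 2) (Fin 2) ℝ) (Z : Matrix SIdx SIdx ℝ)
      (C₁ C₂ : SIdx → ℝ) (R₁ R₂ : ℝ), Q.PosSemidef → (∀ b, qlo * (b ⬝ᵥ b) ≤ quad Q b) →
      Z.PosDef → rlo ≤ R₁ → rlo ≤ R₂ →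
      (∀ a, C₁ (.inl a) ^ 2 ≤ cc) → (∀ a, C₂ (.inl a) ^ 2 ≤ cc) →
      (∀ a, C₁ (.inr a) = 0) → (∀ a, C₂ (.inr a) = 0) →
      ∀ f : SIdx → ℝ,
        f ⬝ᵥ f ≤ D *
          (quad (riccati (predVar t Q (riccati (predVar t Q Z) C₁ R₁)) C₂ R₂) f
            - quad Z ((A₂ t)ᵀ *ᵥ dualUpdate (predVar t Q Z) C₁ R₁
                ((A₂ t)ᵀ *ᵥ dualUpdate (predVar t Q (riccati (predVar t Q Z) C₁ R₁)) C₂ R₂ f))) := by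
  set D₀ := (2 + t ^ 2 / 2) * (3 * (1 / t ^ 4 + cc)) + 2 * cc + 2 / t ^ 2 with hD₀
  have hD₀pos : 0 < D₀ := by positivity
  refine ⟨D₀ * (1 / qlo + 2 / rlo), by positivity, ?_⟩
  intro Q Z C₁ C₂ R₁ R₂ hQ hQlo hZ hR₁ hR₂ hC₁ hC₂ hC₁' hC₂' f
  have hR₁pos := hrlo.trans_le hR₁
  have hR₂pos := hrlo.trans_le hR₂
  set Z₁ := riccati (predVar t Q Z) C₁ R₁ with hZ₁
  have hZ₁pos : Z₁.PosDef := riccati_posDef (predVar_posDef hZ hQ) hR₁pos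
  have hf : f = dualUpdate (predVar t Q Z₁) C₂ R₂ f + (gain (predVar t Q Z₁) C₂ R₂ ⬝ᵥ f) • C₂ := by
    simp [dualUpdate]
  have hV₂ := quad_riccati_predVar (t := t) (C := C₂) hZ₁pos hQ hR₂pos f
  set g₂ := dualUpdate (predVar t Q Z₁) C₂ R₂ f with hg₂
  set κ₂ := gain (predVar t Q Z₁) C₂ R₂ ⬝ᵥ f
  set f₁ := (A₂ t)ᵀ *ᵥ g₂ with hf₁
  have hV₁ := quad_riccati_predVar (t := t) (C := C₁) hZ hQ hR₁pos f₁
  have hg₁' : dualUpdate (predVar t Q Z) C₁ R₁ f₁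
      = f₁ - (gain (predVar t Q Z) C₁ R₁ ⬝ᵥ f₁) • C₁ := rfl
  set g₁ := dualUpdate (predVar t Q Z) C₁ R₁ f₁ with hg₁
  set κ₁ := gain (predVar t Q Z) C₁ R₁ ⬝ᵥ f₁
  rw [hV₂, hZ₁, hV₁]
  have hb₁ := hQlo ((B₂ t)ᵀ *ᵥ g₁)
  have hb₂ := hQlo ((B₂ t)ᵀ *ᵥ g₂)
  have hr₁ : rlo * κ₁ ^ 2 ≤ R₁ * κ₁ ^ 2 := by gcongr
  have hr₂ : rlo * κ₂ ^ 2 ≤ R₂ * κ₂ ^ 2 := by gcongr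
  have hcoord : ∀ a, f (.inl a) ^ 2 + f (.inr a) ^ 2 ≤ D₀ *
      (((B₂ t)ᵀ *ᵥ g₁) a ^ 2 + ((B₂ t)ᵀ *ᵥ g₂) a ^ 2 + κ₁ ^ 2 + κ₂ ^ 2) := fun a => by
    have h := two_step_coordinate (gp := g₂ (.inl a)) (gv := g₂ (.inr a)) (κ₁ := κ₁) (κ₂ := κ₂)
      ht hcc (hC₁ a) (hC₂ a)
    rw [B₂_transpose_mulVec, B₂_transpose_mulVec, hg₁', hf₁, A₂_transpose_mulVec, hf]
    simpa [hC₁', hC₂', hD₀] using h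
  -- Each κ is shared by the two planar axes, hence the factors 2.
  have hsum : f ⬝ᵥ f ≤ D₀ * ((((B₂ t)ᵀ *ᵥ g₁) ⬝ᵥ ((B₂ t)ᵀ *ᵥ g₁))
      + (((B₂ t)ᵀ *ᵥ g₂) ⬝ᵥ ((B₂ t)ᵀ *ᵥ g₂)) + 2 * κ₁ ^ 2 + 2 * κ₂ ^ 2) := by
    rw [dotProduct_SIdx]
    simp only [dotProduct, Fin.sum_univ_two]
    linarith [hcoord 0, hcoord 1]
  refine hsum.trans ?_
  rw [mul_assoc]
  gcongr
  set β₁ := ((B₂ t)ᵀ *ᵥ g₁) ⬝ᵥ ((B₂ t)ᵀ *ᵥ g₁)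
  set β₂ := ((B₂ t)ᵀ *ᵥ g₂) ⬝ᵥ ((B₂ t)ᵀ *ᵥ g₂)
  have q1 : β₁ + β₂ ≤ 1 / qlo * (quad Q ((B₂ t)ᵀ *ᵥ g₁) + quad Q ((B₂ t)ᵀ *ᵥ g₂)) := by
    rw [one_div, le_inv_mul_iff₀ hqlo]
    linarith
  have q2 : 2 * κ₁ ^ 2 + 2 * κ₂ ^ 2 ≤ 2 / rlo * (R₁ * κ₁ ^ 2 + R₂ * κ₂ ^ 2) := by
    rw [div_mul_eq_mul_div, le_div_iff₀ hrlo]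
    linarith
  have n1 := quad_nonneg hQ ((B₂ t)ᵀ *ᵥ g₁)
  have n2 := quad_nonneg hQ ((B₂ t)ᵀ *ᵥ g₂)
  have n3 : 0 ≤ R₁ * κ₁ ^ 2 := by positivity
  have n4 : 0 ≤ R₂ * κ₂ ^ 2 := by positivity
  have m1 : 0 ≤ 1 / qlo * (R₁ * κ₁ ^ 2 + R₂ * κ₂ ^ 2) := by positivity
  have m2 : 0 ≤ 2 / rlo * (quad Q ((B₂ t)ᵀ *ᵥ g₁) + quad Q ((B₂ t)ᵀ *ᵥ g₂)) := by positivity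
  linarith

/-- A lower bound of the variance survives one step. -/
lemma exists_one_step_bound {t rlo cc c : ℝ} (hrlo : 0 < rlo) (hcc : 0 ≤ cc) (hc : 0 < c) :
    ∃ D : ℝ, 0 < D ∧ ∀ (Q : Matrix (Fin 2) (Fin 2) ℝ) (Z : Matrix SIdx SIdx ℝ)
      (C : SIdx → ℝ) (R : ℝ), Q.PosSemidef → Z.PosDef → (∀ f, f ⬝ᵥ f ≤ c * quad Z f) →
      rlo ≤ R → (∀ a, C (.inl a) ^ 2 ≤ cc) → (∀ a, C (.inr a) = 0) →
      ∀ f : SIdx → ℝ, f ⬝ᵥ f ≤ D * quad (riccati (predVar t Q Z) C R) f := by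
  refine ⟨(4 + 4 * t ^ 2) * c + 4 * cc / rlo, by positivity, ?_⟩
  intro Q Z C R hQ hZ hZc hR hC hC' f
  have hRpos := hrlo.trans_le hR
  have hf : f = dualUpdate (predVar t Q Z) C R f + (gain (predVar t Q Z) C R ⬝ᵥ f) • C := by
    simp [dualUpdate]
  have hV := quad_riccati_predVar (t := t) (C := C) hZ hQ hRpos f
  set g := dualUpdate (predVar t Q Z) C R f with hg
  set κ := gain (predVar t Q Z) C R ⬝ᵥ f
  rw [hV]
  have h1 := hZc ((A₂ t)ᵀ *ᵥ g)
  have h2 := quad_nonneg hQ ((B₂ t)ᵀ *ᵥ g)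
  have h3 := quad_nonneg hZ.posSemidef ((A₂ t)ᵀ *ᵥ g)
  have h4 : rlo * κ ^ 2 ≤ R * κ ^ 2 := by gcongr
  have key : ∀ a, f (.inl a) ^ 2 + f (.inr a) ^ 2
      ≤ (4 + 4 * t ^ 2) * (g (.inl a) ^ 2 + (t * g (.inl a) + g (.inr a)) ^ 2)
        + 2 * cc * κ ^ 2 := fun a => by
    have e1 : f (.inl a) = g (.inl a) + κ * C (.inl a) := congrFun hf (.inl a)
    have e2 : f (.inr a) = g (.inr a) := by simpa [hC'] using congrFun hf (.inr a)
    rw [e1, e2]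
    have a2 : (κ * C (.inl a)) ^ 2 ≤ cc * κ ^ 2 := by nlinarith [sq_nonneg κ, hC a]
    generalize g (.inl a) = p
    generalize g (.inr a) = v
    have a3 : v ^ 2 ≤ 2 * (t * p + v) ^ 2 + 2 * (t * p) ^ 2 := by
      nlinarith [sq_nonneg (2 * (t * p) + v)]
    nlinarith [sq_nonneg (p - κ * C (.inl a)), sq_nonneg (t * p), sq_nonneg (t * p + v),
      sq_nonneg (t * (t * p + v)), sq_nonneg p]
  have hs : (A₂ t)ᵀ *ᵥ g ⬝ᵥ (A₂ t)ᵀ *ᵥ g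
      = (g (.inl 0) ^ 2 + (t * g (.inl 0) + g (.inr 0)) ^ 2)
        + (g (.inl 1) ^ 2 + (t * g (.inl 1) + g (.inr 1)) ^ 2) := by
    rw [A₂_transpose_mulVec, dotProduct_SIdx]
    simp only [Sum.elim_inl, Sum.elim_inr]
    ring
  have h5 : f ⬝ᵥ f ≤ (4 + 4 * t ^ 2) * ((A₂ t)ᵀ *ᵥ g ⬝ᵥ (A₂ t)ᵀ *ᵥ g) + 4 * cc * κ ^ 2 := by
    rw [hs, dotProduct_SIdx]
    linarith [key 0, key 1]
  have h6 : (4 + 4 * t ^ 2) * ((A₂ t)ᵀ *ᵥ g ⬝ᵥ (A₂ t)ᵀ *ᵥ g)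
      ≤ (4 + 4 * t ^ 2) * (c * quad Z ((A₂ t)ᵀ *ᵥ g)) := by gcongr
  have h7 : 4 * cc * κ ^ 2 ≤ 4 * cc / rlo * (R * κ ^ 2) := by
    rw [div_mul_eq_mul_div, le_div_iff₀ hrlo]
    nlinarith
  have m0 : 0 ≤ R * κ ^ 2 := by positivity
  have m1 : 0 ≤ (4 + 4 * t ^ 2) * c * (quad Q ((B₂ t)ᵀ *ᵥ g) + R * κ ^ 2) := by positivity
  have m2 : 0 ≤ 4 * cc / rlo * (quad Q ((B₂ t)ᵀ *ᵥ g) + quad Z ((A₂ t)ᵀ *ᵥ g)) := by positivity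
  linarith

end Controllability

/-! ### Observability from four outputs in rotating directions. -/

section Observability

/-- Four successive outputs along a rotating direction determine the state of a planar double
integrator up to the size of its inputs, uniformly in the phase. -/
lemma state_bound_of_rotating_outputs {t α E : ℝ} (ht : 0 < t) (hα : 0 < Real.sin α) (φ : ℝ)
    {X₁ X₂ X₃ X₄ N₁ N₂ N₃ N₄ w₁ w₂ w₃ : Fin 2 → ℝ}
    (hX₂ : ∀ a, X₂ a = X₁ a + t * N₁ a + t ^ 2 / 2 * w₁ a) (hN₂ : ∀ a, N₂ a = N₁ a + t * w₁ a)
    (hX₃ : ∀ a, X₃ a = X₂ a + t * N₂ a + t ^ 2 / 2 * w₂ a) (hN₃ : ∀ a, N₃ a = N₂ a + t * w₂ a)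
    (hX₄ : ∀ a, X₄ a = X₃ a + t * N₃ a + t ^ 2 / 2 * w₃ a) (hN₄ : ∀ a, N₄ a = N₃ a + t * w₃ a)
    (hw₁ : ∀ a, |w₁ a| ≤ E) (hw₂ : ∀ a, |w₂ a| ≤ E) (hw₃ : ∀ a, |w₃ a| ≤ E)
    (hy₁ : |Real.sin (φ - α) * X₁ 0 + Real.cos (φ - α) * X₁ 1| ≤ E)
    (hy₂ : |Real.sin φ * X₂ 0 + Real.cos φ * X₂ 1| ≤ E)
    (hy₃ : |Real.sin (φ + α) * X₃ 0 + Real.cos (φ + α) * X₃ 1| ≤ E)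
    (hy₄ : |Real.sin (φ + 2 * α) * X₄ 0 + Real.cos (φ + 2 * α) * X₄ 1| ≤ E) (a : Fin 2) :
    |X₄ a| ≤ (3 * (1 + (4 + 2 * t ^ 2) / Real.sin α ^ 3) + t ^ 2) * E ∧
    |N₄ a| ≤ (2 * (1 + (4 + 2 * t ^ 2) / Real.sin α ^ 3) / t + 2 * t) * E := by
  have hE : 0 ≤ E := (abs_nonneg _).trans (hw₁ 0)
  set δ₁ : Fin 2 → ℝ := fun a => t ^ 2 / 2 * (w₁ a + w₂ a) with hδ₁
  set δ₂ : Fin 2 → ℝ := fun a => t ^ 2 / 2 * (w₂ a + w₃ a) with hδ₂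
  have hbδ : ∀ u v : ℝ, |u| ≤ E → |v| ≤ E → |t ^ 2 / 2 * (u + v)| ≤ t ^ 2 * E := by
    intro u v hu hv
    rw [abs_mul, abs_of_nonneg (by positivity : (0 : ℝ) ≤ t ^ 2 / 2)]
    calc t ^ 2 / 2 * |u + v| ≤ t ^ 2 / 2 * (E + E) := by
          gcongr
          exact (abs_add_le u v).trans (add_le_add hu hv)
      _ = _ := by ring
  -- Second differences of the position involve inputs only. This eliminates the velocities and
  -- leaves X₂ and X₃ as the unknowns.
  have eX₁ : ∀ a, X₁ a = 2 * X₂ a - X₃ a + δ₁ a := fun a => by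
    rw [hX₃, hN₂, hX₂, hδ₁]
    ring
  have eX₄ : ∀ a, X₄ a = 2 * X₃ a - X₂ a + δ₂ a := fun a => by
    rw [hX₄, hN₃, hX₃, hδ₂]
    ring
  have eN₄ : ∀ a, N₄ a = (X₃ a - X₂ a) / t + t / 2 * w₂ a + t * w₃ a := fun a => by
    rw [hN₄, hN₃, hX₃]
    field_simp
    ring
  have hsc : Real.sin φ ^ 2 + Real.cos φ ^ 2 = 1 := Real.sin_sq_add_cos_sq φ
  have hsc' : Real.sin α ^ 2 + Real.cos α ^ 2 = 1 := Real.sin_sq_add_cos_sq α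
  have hmul : ∀ u v M : ℝ, |u| ≤ 1 → |v| ≤ M → |u * v| ≤ M := fun u v M hu hv => by
    rw [abs_mul]
    nlinarith [abs_nonneg u, abs_nonneg v]
  set y₁ := Real.sin (φ - α) * X₁ 0 + Real.cos (φ - α) * X₁ 1 with hdy₁
  set y₂ := Real.sin φ * X₂ 0 + Real.cos φ * X₂ 1 with hdy₂
  set y₃ := Real.sin (φ + α) * X₃ 0 + Real.cos (φ + α) * X₃ 1 with hdy₃
  set y₄ := Real.sin (φ + 2 * α) * X₄ 0 + Real.cos (φ + 2 * α) * X₄ 1 with hdy₄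
  -- The components of X₂ and X₃ along their output directions are measured; r₂ and r₃ are the
  -- missing orthogonal ones. The first and last outputs give two linear equations for them.
  set r₂ := Real.cos φ * X₂ 0 - Real.sin φ * X₂ 1 with hr₂
  set r₃ := Real.cos (φ + α) * X₃ 0 - Real.sin (φ + α) * X₃ 1 with hr₃
  set u := y₁ - (Real.sin (φ - α) * δ₁ 0 + Real.cos (φ - α) * δ₁ 1) - 2 * (Real.cos α * y₂)
    + Real.cos (2 * α) * y₃ with hu
  set v := y₄ - (Real.sin (φ + 2 * α) * δ₂ 0 + Real.cos (φ + 2 * α) * δ₂ 1)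
    - 2 * (Real.cos α * y₃) + Real.cos (2 * α) * y₂ with hv
  have hu' : 2 * Real.sin α * (Real.cos α * r₃ - r₂) = u := by
    rw [hu, hdy₁, hdy₂, hdy₃, hr₂, hr₃, eX₁, eX₁, Real.sin_sub, Real.cos_sub, Real.sin_add,
      Real.cos_add, Real.cos_two_mul]
    generalize Real.sin φ = s at *
    generalize Real.cos φ = c at *
    generalize Real.sin α = σ at *
    generalize Real.cos α = κ at *
    have : σ ^ 2 = 1 - κ ^ 2 := by linarith
    ring_nf
    simp only [this]
    ring_nf
  have hv' : 2 * Real.sin α * (r₃ - Real.cos α * r₂) = v := by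
    rw [hv, hdy₄, hdy₂, hdy₃, hr₂, hr₃, eX₄, eX₄, Real.sin_add φ (2 * α),
      Real.cos_add φ (2 * α), Real.sin_add φ α, Real.cos_add φ α, Real.sin_two_mul,
      Real.cos_two_mul]
    generalize Real.sin φ = s at *
    generalize Real.cos φ = c at *
    generalize Real.sin α = σ at *
    generalize Real.cos α = κ at *
    have : σ ^ 2 = 1 - κ ^ 2 := by linarith
    ring_nf
    simp only [this]
    ring_nf
  have hbu : |u| ≤ (4 + 2 * t ^ 2) * E := by
    have b1 := hmul _ _ _ (Real.abs_sin_le_one (φ - α)) (hbδ _ _ (hw₁ 0) (hw₂ 0))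
    have b2 := hmul _ _ _ (Real.abs_cos_le_one (φ - α)) (hbδ _ _ (hw₁ 1) (hw₂ 1))
    have b3 := hmul _ _ _ (Real.abs_cos_le_one α) hy₂
    have b4 := hmul _ _ _ (Real.abs_cos_le_one (2 * α)) hy₃
    rw [hu, hδ₁]
    rw [abs_le] at *
    constructor <;> linarith
  have hbv : |v| ≤ (4 + 2 * t ^ 2) * E := by
    have b1 := hmul _ _ _ (Real.abs_sin_le_one (φ + 2 * α)) (hbδ _ _ (hw₂ 0) (hw₃ 0))
    have b2 := hmul _ _ _ (Real.abs_cos_le_one (φ + 2 * α)) (hbδ _ _ (hw₂ 1) (hw₃ 1))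
    have b3 := hmul _ _ _ (Real.abs_cos_le_one α) hy₃
    have b4 := hmul _ _ _ (Real.abs_cos_le_one (2 * α)) hy₂
    rw [hv, hδ₂]
    rw [abs_le] at *
    constructor <;> linarith
  have hbr₂ : |r₂| ≤ (4 + 2 * t ^ 2) / Real.sin α ^ 3 * E := by
    -- The 2 × 2 system has a common factor 2 sin α and, beside it, determinant −sin²α; hence the
    -- cube.
    have e : Real.sin α ^ 3 * r₂ = (Real.cos α * v - u) / 2 := by
      rw [← hu', ← hv']
      linear_combination Real.sin α * r₂ * hsc'
    have b := hmul _ _ _ (Real.abs_cos_le_one α) hbv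
    rw [div_mul_eq_mul_div, le_div_iff₀ (by positivity), ← abs_of_pos (pow_pos hα 3), ← abs_mul,
      mul_comm, e]
    rw [abs_le] at *
    constructor <;> linarith
  have hbr₃ : |r₃| ≤ (4 + 2 * t ^ 2) / Real.sin α ^ 3 * E := by
    have e : Real.sin α ^ 3 * r₃ = (v - Real.cos α * u) / 2 := by
      rw [← hu', ← hv']
      linear_combination Real.sin α * r₃ * hsc'
    have b := hmul _ _ _ (Real.abs_cos_le_one α) hbu
    rw [div_mul_eq_mul_div, le_div_iff₀ (by positivity), ← abs_of_pos (pow_pos hα 3), ← abs_mul,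
      mul_comm, e]
    rw [abs_le] at *
    constructor <;> linarith
  set ϱ := (4 + 2 * t ^ 2) / Real.sin α ^ 3
  have hrec : ∀ (ψ : ℝ) (X : Fin 2 → ℝ), |Real.sin ψ * X 0 + Real.cos ψ * X 1| ≤ E →
      |Real.cos ψ * X 0 - Real.sin ψ * X 1| ≤ ϱ * E → ∀ a, |X a| ≤ (1 + ϱ) * E := by
    intro ψ X h1 h2 a
    have hψ := Real.sin_sq_add_cos_sq ψ
    fin_cases a
    · have e : X 0 = Real.sin ψ * (Real.sin ψ * X 0 + Real.cos ψ * X 1)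
          + Real.cos ψ * (Real.cos ψ * X 0 - Real.sin ψ * X 1) := by
        linear_combination (-X 0) * hψ
      have b1 := hmul _ _ _ (Real.abs_sin_le_one ψ) h1
      have b2 := hmul _ _ _ (Real.abs_cos_le_one ψ) h2
      simp only [Fin.zero_eta]
      rw [e]
      refine (abs_add_le _ _).trans ?_
      linarith
    · have e : X 1 = Real.cos ψ * (Real.sin ψ * X 0 + Real.cos ψ * X 1)
          + -(Real.sin ψ * (Real.cos ψ * X 0 - Real.sin ψ * X 1)) := by
        linear_combination (-X 1) * hψ
      have b1 := hmul _ _ _ (Real.abs_cos_le_one ψ) h1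
      have b2 := hmul _ _ _ (Real.abs_sin_le_one ψ) h2
      simp only [Fin.mk_one]
      rw [e]
      refine (abs_add_le _ _).trans ?_
      rw [abs_neg]
      linarith
  have hbX₂ := hrec φ X₂ hy₂ hbr₂ a
  have hbX₃ := hrec (φ + α) X₃ hy₃ hbr₃ a
  constructor
  · have b := hbδ _ _ (hw₂ a) (hw₃ a)
    rw [eX₄]
    simp only [hδ₂]
    rw [abs_le] at *
    constructor <;> linarith
  · rw [eN₄]
    have b1 : |(X₃ a - X₂ a) / t| ≤ 2 * (1 + ϱ) / t * E := by
      rw [abs_div, abs_of_pos ht, div_mul_eq_mul_div]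
      gcongr
      refine (abs_sub _ _).trans ?_
      linarith
    have b2 : |t / 2 * w₂ a| ≤ t / 2 * E := by
      rw [abs_mul, abs_of_pos (by positivity : 0 < t / 2)]
      gcongr
      exact hw₂ a
    have b3 : |t * w₃ a| ≤ t * E := by
      rw [abs_mul, abs_of_pos ht]
      gcongr
      exact hw₃ a
    have b4 : 0 ≤ t * E := by positivity
    rw [abs_le] at *
    constructor <;> linarith

end Observability

/-! ### Drone geometry and two-sided bounds of the Riccati variance. -/

lemma F_mulVec (y : Fin 3 → ℝ) : F *ᵥ y = ![y 0, y 1] := by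
  ext a
  fin_cases a <;> simp [F, mulVec, dotProduct, Fin.sum_univ_three]

lemma F_transpose_mulVec (y : Fin 2 → ℝ) : Fᵀ *ᵥ y = ![y 0, y 1, 0] := by
  ext a
  fin_cases a <;> simp [F, mulVec, dotProduct, Fin.sum_univ_two, Matrix.transpose_apply]

lemma F_mulVec_transpose_mulVec (y : Fin 2 → ℝ) : F *ᵥ (Fᵀ *ᵥ y) = y := by
  rw [F_mulVec, F_transpose_mulVec]
  ext a
  fin_cases a <;> simp

lemma sq_le_of_vecMulVec_le {n : Type*} [Fintype n] [DecidableEq n] {p : n → ℝ} {c : ℝ}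
    (h : vecMulVec p p ≤ c • (1 : Matrix n n ℝ)) (a : n) : p a ^ 2 ≤ c := by
  have := quad_le_of_le_smul_one h (Pi.single a 1)
  simpa [quad, vecMulVec_apply, sq] using this

namespace Scenario

variable {Ω : Type*} {M N : ℕ} (S : Scenario Ω M N)

lemma ζ_succ (j : Fin M) (k : ℕ) (ω : Ω) :
    S.ζ j (k + 1) ω = riccati (predVar S.t (S.Q j) (S.ζ j k ω)) (S.C j (k + 1) ω)
      (S.Υhat j (k + 1) ω) := rfl

lemma C_inr (j : Fin M) (k : ℕ) (ω : Ω) (a : Fin 2) : S.C j k ω (.inr a) = 0 := rfl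

lemma C_inl_sq_le {j : Fin M} {k : ℕ} {ω : Ω} {c : ℝ}
    (h : vecMulVec (S.p j k ω) (S.p j k ω) ≤ c • (1 : Matrix (Fin 3) (Fin 3) ℝ)) (a : Fin 2) :
    S.C j k ω (.inl a) ^ 2 ≤ 4 * c := by
  have h0 := sq_le_of_vecMulVec_le h 0
  have h1 := sq_le_of_vecMulVec_le h 1
  fin_cases a <;> simp [C, outRow, F_mulVec, mul_pow] <;> linarith

variable {S}

lemma ζ_posDef {j : Fin M} {ω : Ω} (h₀ : (S.ζ₀ j).PosDef) (hQ : (S.Q j).PosSemidef)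
    (hR : ∀ k, 0 < S.Υhat j k ω) (k : ℕ) : (S.ζ j k ω).PosDef := by
  induction k with
  | zero => exact h₀
  | succ k ih =>
    rw [ζ_succ]
    exact riccati_posDef (predVar_posDef ih hQ) (hR _)

section Model

variable {qlo qhi rlo rhi c : ℝ}

/-- Affine recursion for the growth of an upper bound of the Riccati variance. -/
def growth (a b c : ℝ) : ℕ → ℝ
  | 0 => c
  | k + 1 => a * growth a b c k + b

lemma growth_nonneg {a b c : ℝ} (ha : 1 ≤ a) (hb : 0 ≤ b) (hc : 0 ≤ c) (k : ℕ) :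
    0 ≤ growth a b c k := by
  induction k with
  | zero => exact hc
  | succ k ih =>
    rw [growth]
    positivity

lemma growth_mono {a b c : ℝ} (ha : 1 ≤ a) (hb : 0 ≤ b) (hc : 0 ≤ c) :
    Monotone (growth a b c) :=
  monotone_nat_of_le_succ fun k => by
    rw [growth]
    nlinarith [growth_nonneg ha hb hc k]

/-- Transports an upper bound from an instant n where one is known. The crude growth is harmless,
since only boundedly many steps are bridged. -/
lemma mulVec_sq_le_growth {j : Fin M} {ω : Ω} (hpos : ∀ k, (S.ζ j k ω).PosDef)
    (hQ : (S.Q j).PosSemidef) (hqhi : 0 < qhi)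
    (hQhi : ∀ b, quad (S.Q j) b ≤ qhi * (b ⬝ᵥ b)) (hR : ∀ k, 0 < S.Υhat j k ω) {n : ℕ}
    (hc : 0 ≤ c) (h : ∀ f, (S.ζ j n ω *ᵥ f) ⬝ᵥ (S.ζ j n ω *ᵥ f) ≤ c * quad (S.ζ j n ω) f)
    (k : ℕ) (f : SIdx → ℝ) :
    (S.ζ j (n + k) ω *ᵥ f) ⬝ᵥ (S.ζ j (n + k) ω *ᵥ f)
      ≤ growth (6 + 4 * S.t ^ 2) ((S.t ^ 4 + 2 * S.t ^ 2) * qhi) c k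
        * quad (S.ζ j (n + k) ω) f := by
  induction k generalizing f with
  | zero => exact h f
  | succ k ih =>
    rw [← add_assoc, ζ_succ, growth]
    exact mulVec_sq_le_step (hpos _) hQ hqhi hQhi (hR _)
      (growth_nonneg (by nlinarith [sq_nonneg S.t]) (by positivity) hc k) ih f

/-- Without interaction and repulsion the planar positions of both drones are reset to opposite
points around the predicted target position. -/
lemma C_succ_of_quiet (ht : S.t ≠ 0)
    (hpos : ∀ h k ω, S.x h (k + 1) ω = S.x h k ω + S.t • S.v h k ω + (S.t ^ 2 / 2) • S.u h k ω)
    {ρ : ℝ} {ℓ : ℕ} {Γaux : Fin N → ℕ → Ω → Fin 3 → ℝ} {j : Fin M}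
    (henc : S.Encircles ρ ℓ Γaux j) {k : ℕ} {ω : Ω} (hi : Γaux (S.i j) k ω = 0)
    (hg : Γaux (S.g j) k ω = 0) (y : SIdx → ℝ) :
    S.C j (k + 1) ω ⬝ᵥ y = -4 * ρ * (Real.sin (1 / (ℓ : ℝ) * k * Real.pi) * y (.inl 0)
      + Real.cos (1 / (ℓ : ℝ) * k * Real.pi) * y (.inl 1)) := by
  have hx : ∀ (h : Fin N) (r : Fin 2 → ℝ),
      S.u h k ω = S.attract h j r k ω + 0 - (2 / S.t) • S.v h k ω →
      F *ᵥ S.x h (k + 1) ω = (fun a => S.ηhat j k ω (Sum.inl a)) + r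
        + S.t • (fun a => S.ηhat j k ω (Sum.inr a)) := by
    intro h r hu
    -- The damping −(2/t)v cancels the drift tv, and the attraction times t²/2 is exactly the planar
    -- displacement still missing.
    have e : S.x h (k + 1) ω = S.x h k ω - Fᵀ *ᵥ (F *ᵥ S.x h k ω
        - (fun a => S.ηhat j k ω (Sum.inl a)) - r
        - S.t • (fun a => S.ηhat j k ω (Sum.inr a))) := by
      rw [hpos, hu, attract]
      ext a
      simp only [Pi.add_apply, Pi.sub_apply, Pi.smul_apply, smul_eq_mul, Pi.zero_apply]
      field_simp
      ring
    rw [e, mulVec_sub, F_mulVec_transpose_mulVec]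
    abel
  have h1 := hx _ _ (hi ▸ (henc k ω).1)
  have h2 := hx _ _ (hg ▸ (henc k ω).2)
  have h3 : F *ᵥ S.p j (k + 1) ω = (2 : ℝ) • shape ρ ℓ k := by
    rw [p, mulVec_sub, h1, h2, two_smul]
    abel
  rw [C, outRow, h3, dotProduct_SIdx]
  simp [shape]
  ring

variable [MeasurableSpace Ω] {μ : Measure Ω}

lemma NoiseBounds.Q_posSemidef (h : S.NoiseBounds μ qlo qhi rlo rhi) (hqlo : 0 < qlo)
    (j : Fin M) : (S.Q j).PosSemidef :=
  posSemidef_of_quad (transpose_eq_of_smul_one_le (h.Q_lo j)) fun f =>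
    (mul_nonneg hqlo.le (dotProduct_self_nonneg_real f)).trans (le_quad_of_smul_one_le (h.Q_lo j) f)

/-- The Riccati variance is bounded from below, uniformly in time. -/
lemma exists_le_quad_ζ (hS : S.IsModel μ) (h : S.NoiseBounds μ qlo qhi rlo rhi)
    (hg : S.GroupBounded μ c) (hqlo : 0 < qlo) (hrlo : 0 < rlo) (hc : 0 < c) (j : Fin M) :
    ∃ D : ℝ, 0 < D ∧ ∀ᵐ ω ∂μ, ∀ k f, f ⬝ᵥ f ≤ D * quad (S.ζ j k ω) f := by
  have hQ := h.Q_posSemidef hqlo j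
  have hQlo := le_quad_of_smul_one_le (h.Q_lo j)
  obtain ⟨D₀, hD₀, h₀⟩ := exists_le_quad (hS.ζ₀_pos j)
  obtain ⟨D₁, hD₁, h₁⟩ := exists_one_step_bound (t := S.t) (cc := 4 * c) hrlo (by positivity) hD₀
  obtain ⟨D₂, hD₂, h₂⟩ :=
    exists_two_step_bound (cc := 4 * c) hS.t_pos hqlo hrlo (by positivity)
  refine ⟨D₀ + D₁ + D₂, by positivity, ?_⟩
  filter_upwards [hg j, h.Υhat_lo j] with ω hp hR k f
  have hpos := ζ_posDef (hS.ζ₀_pos j) hQ fun k => hrlo.trans_le (hR k)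
  have hV := quad_nonneg (hpos k).posSemidef f
  -- The two-step estimate starts at k = 2; the deterministic initial variance and one step from it
  -- cover 0 and 1.
  match k with
  | 0 =>
    refine (h₀ f).trans ?_
    change D₀ * quad (S.ζ j 0 ω) f ≤ _
    gcongr
    linarith
  | 1 =>
    refine (h₁ _ _ _ _ hQ (hS.ζ₀_pos j) h₀ (hR 1) (S.C_inl_sq_le (hp 1)) (S.C_inr j 1 ω)
      f).trans ?_
    change D₁ * quad (S.ζ j 1 ω) f ≤ _
    gcongr
    linarith
  | k + 2 =>
    refine (h₂ _ _ _ _ _ _ hQ hQlo (hpos k) (hR (k + 1)) (hR (k + 2))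
      (S.C_inl_sq_le (hp (k + 1))) (S.C_inl_sq_le (hp (k + 2))) (S.C_inr j (k + 1) ω)
      (S.C_inr j (k + 2) ω) f).trans ?_
    rw [← ζ_succ, ← ζ_succ]
    refine (mul_le_mul_of_nonneg_left
      (sub_le_self _ (quad_nonneg (hpos k).posSemidef _)) hD₂.le).trans ?_
    exact mul_le_mul_of_nonneg_right (by linarith) hV

/-- Four quiet instants bound the Riccati variance from above. -/
lemma exists_mulVec_sq_le_of_quiet (hS : S.IsModel μ) (h : S.NoiseBounds μ qlo qhi rlo rhi)
    (hqlo : 0 < qlo) (hqhi : 0 < qhi) (hrlo : 0 < rlo) (hrhi : 0 < rhi)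
    {ρ : ℝ} {ℓ : ℕ} {Γaux : Fin N → ℕ → Ω → Fin 3 → ℝ} (hρ : 0 < ρ) (hℓ : 4 ≤ ℓ) {j : Fin M}
    (henc : S.Encircles ρ ℓ Γaux j) :
    ∃ D : ℝ, 0 < D ∧ ∀ ω, (∀ k, rlo ≤ S.Υhat j k ω) → (∀ k, S.Υhat j k ω ≤ rhi) →
      ∀ k₁, (∀ n, k₁ ≤ n → n ≤ k₁ + 3 → Γaux (S.i j) n ω = 0 ∧ Γaux (S.g j) n ω = 0) →
      ∀ f, (S.ζ j (k₁ + 4) ω *ᵥ f) ⬝ᵥ (S.ζ j (k₁ + 4) ω *ᵥ f)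
        ≤ D * quad (S.ζ j (k₁ + 4) ω) f := by
  have hQ := h.Q_posSemidef hqlo j
  have hQhi := quad_le_of_le_smul_one (h.Q_hi j)
  have ht := hS.t_pos
  have hℓ' : (4 : ℝ) ≤ ℓ := by exact_mod_cast hℓ
  set α : ℝ := 1 / (ℓ : ℝ) * Real.pi with hα
  have hsin : 0 < Real.sin α := by
    apply Real.sin_pos_of_pos_of_lt_pi
    · have := Real.pi_pos
      positivity
    · rw [hα, one_div, inv_mul_lt_iff₀ (by positivity)]
      nlinarith [Real.pi_pos]
  set κX := 3 * (1 + (4 + 2 * S.t ^ 2) / Real.sin α ^ 3) + S.t ^ 2 with hκX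
  set κN := 2 * (1 + (4 + 2 * S.t ^ 2) / Real.sin α ^ 3) / S.t + 2 * S.t with hκN
  -- The outputs carry the factor −4ρ; dividing by its square and adding the input bound gives one
  -- constant for both.
  set B := qhi + rhi / (4 * ρ) ^ 2 with hB
  have hBpos : 0 < B := by positivity
  refine ⟨2 * (κX ^ 2 + κN ^ 2) * B, by positivity, ?_⟩
  intro ω hR hRhi k₁ hquiet f₄
  have hpos := ζ_posDef (hS.ζ₀_pos j) hQ fun k => hrlo.trans_le (hR k)
  have back : ∀ k f, ∃ (f₀ : SIdx → ℝ) (w : Fin 2 → ℝ),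
      S.ζ j (k + 1) ω *ᵥ f = A₂ S.t *ᵥ (S.ζ j k ω *ᵥ f₀) + B₂ S.t *ᵥ w ∧
      quad (S.ζ j k ω) f₀ ≤ quad (S.ζ j (k + 1) ω) f ∧
      w ⬝ᵥ w ≤ qhi * (quad (S.ζ j (k + 1) ω) f - quad (S.ζ j k ω) f₀) ∧
      (S.C j (k + 1) ω ⬝ᵥ (S.ζ j (k + 1) ω *ᵥ f)) ^ 2
        ≤ rhi * (quad (S.ζ j (k + 1) ω) f - quad (S.ζ j k ω) f₀) := fun k f =>
    exists_backward_step (hpos k) hQ hqhi hQhi (hrlo.trans_le (hR _)) (hRhi _) f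
  obtain ⟨f₃, w₃, hx₃, hV₃, hw₃, hy₃⟩ := back (k₁ + 3) f₄
  obtain ⟨f₂, w₂, hx₂, hV₂, hw₂, hy₂⟩ := back (k₁ + 2) f₃
  obtain ⟨f₁, w₁, hx₁, hV₁, hw₁, hy₁⟩ := back (k₁ + 1) f₂
  obtain ⟨f₀, w₀, hx₀, hV₀, hw₀, hy₀⟩ := back k₁ f₁
  have hn := quad_nonneg (hpos k₁).posSemidef f₀
  set V := quad (S.ζ j (k₁ + 3 + 1) ω) f₄ with hV
  change (S.ζ j (k₁ + 3 + 1) ω *ᵥ f₄) ⬝ᵥ (S.ζ j (k₁ + 3 + 1) ω *ᵥ f₄) ≤ _ * V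
  have hVn : 0 ≤ V := by linarith
  clear_value V κX κN
  set E := Real.sqrt (B * V) with hE
  have hE2 : E ^ 2 = B * V := Real.sq_sqrt (mul_nonneg hBpos.le hVn)
  have hwE : ∀ (w : Fin 2 → ℝ) (d : ℝ), w ⬝ᵥ w ≤ qhi * d → d ≤ V → ∀ a, |w a| ≤ E := by
    intro w d hw hd a
    apply Real.abs_le_sqrt
    have h1 : w a ^ 2 ≤ w ⬝ᵥ w := by
      rw [sq]
      exact Finset.single_le_sum (f := fun i => w i * w i) (fun i _ => mul_self_nonneg (w i))
        (Finset.mem_univ a)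
    have h2 : qhi * d ≤ qhi * V := mul_le_mul_of_nonneg_left hd hqhi.le
    have h3 : 0 ≤ rhi / (4 * ρ) ^ 2 * V := mul_nonneg (by positivity) hVn
    rw [hB]
    linarith
  have hyE : ∀ k, k₁ ≤ k → k ≤ k₁ + 3 → ∀ (f : SIdx → ℝ) (d : ℝ),
      (S.C j (k + 1) ω ⬝ᵥ (S.ζ j (k + 1) ω *ᵥ f)) ^ 2 ≤ rhi * d → d ≤ V →
      |Real.sin (1 / (ℓ : ℝ) * k * Real.pi) * (S.ζ j (k + 1) ω *ᵥ f) (.inl 0)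
        + Real.cos (1 / (ℓ : ℝ) * k * Real.pi) * (S.ζ j (k + 1) ω *ᵥ f) (.inl 1)| ≤ E := by
    intro k hk hk' f d hy hd
    obtain ⟨hi, hg⟩ := hquiet k hk hk'
    rw [C_succ_of_quiet ht.ne' hS.drone_pos henc hi hg] at hy
    apply Real.abs_le_sqrt
    have h2 : rhi * d ≤ rhi * V := mul_le_mul_of_nonneg_left hd hrhi.le
    have h3 : 0 ≤ qhi * V := mul_nonneg hqhi.le hVn
    generalize Real.sin (1 / (ℓ : ℝ) * k * Real.pi) * (S.ζ j (k + 1) ω *ᵥ f) (.inl 0)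
        + Real.cos (1 / (ℓ : ℝ) * k * Real.pi) * (S.ζ j (k + 1) ω *ᵥ f) (.inl 1) = y at hy
    have h4 : y ^ 2 ≤ rhi * V / (4 * ρ) ^ 2 := by
      rw [le_div_iff₀ (by positivity)]
      linarith
    calc y ^ 2 ≤ _ := h4
      _ = rhi / (4 * ρ) ^ 2 * V := by ring
      _ ≤ _ := by
        rw [hB]
        linarith
  have c₀ := hyE k₁ (by omega) (by omega) f₁ _ hy₀ (by linarith)
  have c₁ := hyE (k₁ + 1) (by omega) (by omega) f₂ _ hy₁ (by linarith)
  have c₂ := hyE (k₁ + 2) (by omega) (by omega) f₃ _ hy₂ (by linarith)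
  have c₃ := hyE (k₁ + 3) (by omega) (by omega) f₄ _ hy₃ (by linarith)
  have dynX : ∀ {x' x : SIdx → ℝ} {w : Fin 2 → ℝ}, x' = A₂ S.t *ᵥ x + B₂ S.t *ᵥ w →
      ∀ a, x' (.inl a) = x (.inl a) + S.t * x (.inr a) + S.t ^ 2 / 2 * w a := by
    rintro _ x w rfl a
    simp [A₂_mulVec, B₂_mulVec]
  have dynN : ∀ {x' x : SIdx → ℝ} {w : Fin 2 → ℝ}, x' = A₂ S.t *ᵥ x + B₂ S.t *ᵥ w →
      ∀ a, x' (.inr a) = x (.inr a) + S.t * w a := by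
    rintro _ x w rfl a
    simp [A₂_mulVec, B₂_mulVec]
  -- The output at k+1 has the phase of instant k. The reference phase φ is that of k₁ + 1, the
  -- second of the four.
  have p₀ : 1 / (ℓ : ℝ) * (k₁ : ℝ) * Real.pi = 1 / (ℓ : ℝ) * ((k₁ + 1 : ℕ) : ℝ) * Real.pi - α := by
    push_cast
    rw [hα]
    ring
  have p₂ : 1 / (ℓ : ℝ) * ((k₁ + 2 : ℕ) : ℝ) * Real.pi
      = 1 / (ℓ : ℝ) * ((k₁ + 1 : ℕ) : ℝ) * Real.pi + α := by
    push_cast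
    rw [hα]
    ring
  have p₃ : 1 / (ℓ : ℝ) * ((k₁ + 3 : ℕ) : ℝ) * Real.pi
      = 1 / (ℓ : ℝ) * ((k₁ + 1 : ℕ) : ℝ) * Real.pi + 2 * α := by
    push_cast
    rw [hα]
    ring
  rw [p₀] at c₀
  rw [p₂] at c₂
  rw [p₃] at c₃
  have key := state_bound_of_rotating_outputs ht hsin _ (dynX hx₁) (dynN hx₁) (dynX hx₂)
    (dynN hx₂) (dynX hx₃) (dynN hx₃) (hwE _ _ hw₁ (by linarith)) (hwE _ _ hw₂ (by linarith))
    (hwE _ _ hw₃ (by linarith)) c₀ c₁ c₂ c₃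
  rw [← hκX, ← hκN] at key
  have kX : ∀ a, (S.ζ j (k₁ + 3 + 1) ω *ᵥ f₄) (.inl a) ^ 2 ≤ κX ^ 2 * (B * V) := fun a => by
    rw [← hE2, ← mul_pow]
    exact sq_le_sq' (abs_le.1 (key a).1).1 (abs_le.1 (key a).1).2
  have kN : ∀ a, (S.ζ j (k₁ + 3 + 1) ω *ᵥ f₄) (.inr a) ^ 2 ≤ κN ^ 2 * (B * V) := fun a => by
    rw [← hE2, ← mul_pow]
    exact sq_le_sq' (abs_le.1 (key a).2).1 (abs_le.1 (key a).2).2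
  rw [dotProduct_SIdx]
  linarith [kX 0, kX 1, kN 0, kN 1]

theorem varianceBounded_of_encircles (hS : S.IsModel μ) (h : S.NoiseBounds μ qlo qhi rlo rhi)
    (hgr : S.GroupBounded μ c) (hqlo : 0 < qlo) (hqhi : 0 < qhi) (hrlo : 0 < rlo)
    (hrhi : 0 < rhi) (hc : 0 < c) {ρ : ℝ} {ℓ : ℕ} {Γaux : Fin N → ℕ → Ω → Fin 3 → ℝ}
    (hρ : 0 < ρ) (hℓ : 4 ≤ ℓ) {j : Fin M} (henc : S.Encircles ρ ℓ Γaux j)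
    (hqw : S.QuietWindows μ Γaux j) : S.VarianceBounded μ j := by
  have hQ := h.Q_posSemidef hqlo j
  have hQhi := quad_le_of_le_smul_one (h.Q_hi j)
  obtain ⟨D, hD, hlow⟩ := exists_le_quad_ζ hS h hgr hqlo hrlo hc j
  obtain ⟨D₁, hD₁, hquiet⟩ :=
    exists_mulVec_sq_le_of_quiet hS h hqlo hqhi hrlo hrhi hρ hℓ henc
  obtain ⟨D₀, hD₀, hζ₀⟩ := exists_quad_le (S.ζ₀ j)
  obtain ⟨m₁, -, hwin⟩ := hqw
  have ha : (1 : ℝ) ≤ 6 + 4 * S.t ^ 2 := by nlinarith [sq_nonneg S.t]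
  have hb : 0 ≤ (S.t ^ 4 + 2 * S.t ^ 2) * qhi := by positivity
  have hc₀ : 0 ≤ D₀ + D₁ := by positivity
  set G := growth (6 + 4 * S.t ^ 2) ((S.t ^ 4 + 2 * S.t ^ 2) * qhi) (D₀ + D₁) with hG
  have hGpos : 0 < G m₁ :=
    (by positivity : 0 < D₀ + D₁).trans_le (growth_mono ha hb hc₀ (Nat.zero_le m₁))
  refine ⟨(G m₁)⁻¹, inv_pos.2 hGpos, D, hD, ?_⟩
  filter_upwards [hlow, hwin, h.Υhat_lo j, h.Υhat_hi j] with ω hlow hwin hR hRhi k hk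
  have hRpos : ∀ k, 0 < S.Υhat j k ω := fun k => hrlo.trans_le (hR k)
  have hpos := ζ_posDef (hS.ζ₀_pos j) hQ hRpos
  refine ⟨le_inv_of_mulVec_sq_le (hpos k) hGpos fun f => ?_,
    inv_le_of_le_quad (hpos k) hD (hlow k)⟩
  -- The starting instant n is 0 or the end of a quiet group; D₀ + D₁ serves both cases.
  obtain ⟨n, i, hni, hi, hn⟩ : ∃ n i, k = n + i ∧ i ≤ m₁ ∧
      ∀ f, (S.ζ j n ω *ᵥ f) ⬝ᵥ (S.ζ j n ω *ᵥ f) ≤ (D₀ + D₁) * quad (S.ζ j n ω) f := by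
    by_cases hkm : k ≤ m₁
    · refine ⟨0, k, by omega, hkm, fun f => ?_⟩
      refine (mulVec_sq_le (hpos 0).posSemidef hD₀ hζ₀ f).trans ?_
      gcongr
      · exact quad_nonneg (hpos 0).posSemidef f
      · linarith
    -- The window is taken at k − 1 because a quiet instant shapes the output one step later, so
    -- that k₁ + 4 ≤ k.
    · obtain ⟨k₁, h1, h2, h3⟩ := hwin (k - 1) (by omega)
      refine ⟨k₁ + 4, k - (k₁ + 4), by omega, by omega, fun f => ?_⟩
      refine (hquiet ω hR hRhi k₁ h3 f).trans ?_
      gcongr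
      · exact quad_nonneg (hpos _).posSemidef f
      · linarith
  subst hni
  refine (mulVec_sq_le_growth hpos hQ hqhi hQhi hRpos hc₀ hn i f).trans ?_
  gcongr
  · exact quad_nonneg (hpos _).posSemidef f
  · exact growth_mono ha hb hc₀ hi

end Model

end Scenario

/-! ### Pathwise contraction of the estimation error. -/

lemma eNorm_sq {n : Type*} [Fintype n] (v : n → ℝ) : eNorm v ^ 2 = v ⬝ᵥ v := by
  rw [eNorm, EuclideanSpace.real_norm_sq_eq]
  simp [dotProduct, sq]

lemma dotProduct_sq_le {n : Type*} [Fintype n] (u v : n → ℝ) :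
    (u ⬝ᵥ v) ^ 2 ≤ (u ⬝ᵥ u) * (v ⬝ᵥ v) := by
  simpa [dotProduct, sq] using Finset.sum_mul_sq_le_sq_mul_sq Finset.univ u v

lemma add_sq_le_add_mul_add {p q a b c d : ℝ} (ha : 0 ≤ a) (hb : 0 ≤ b) (hc : 0 ≤ c) (hd : 0 ≤ d)
    (hp : p ^ 2 ≤ a * c) (hq : q ^ 2 ≤ b * d) : (p + q) ^ 2 ≤ (a + b) * (c + d) := by
  have h1 : (2 * (p * q)) ^ 2 ≤ (a * d + b * c) ^ 2 := by
    have : p ^ 2 * q ^ 2 ≤ (a * c) * (b * d) := by gcongr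
    nlinarith [sq_nonneg (a * d - b * c)]
  have h2 : 2 * (p * q) ≤ a * d + b * c := abs_le_of_sq_le_sq' h1 (by positivity) |>.2
  nlinarith

/-- Scalar core of the two-step contraction: `Vᵢ` are the weights, `yᵢ` the tested errors. -/
lemma sq_le_of_two_step_contraction {T v n₀ n₁ V₀ V₁ V₂ y₀ y₁ y₂ : ℝ} (hT : 0 < T) (hv : 0 ≤ v)
    (hn₀ : 0 ≤ n₀) (hn₁ : 0 ≤ n₁) (h0 : 0 ≤ V₀) (h01 : V₀ ≤ V₁) (h12 : V₁ ≤ V₂)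
    (hy₀ : y₀ ^ 2 ≤ v * V₀)
    (hinc : (y₁ - y₀ + (y₂ - y₁)) ^ 2 ≤ (n₀ + n₁) * (V₁ - V₀ + (V₂ - V₁)))
    (hV : V₂ ≤ T * (V₂ - V₀)) :
    y₂ ^ 2 ≤ ((2 * T + 1) / (2 * T + 2) * v + (1 + 2 * T) * (n₀ + n₁)) * V₂ := by
  have a1 : (y₂ - y₀) ^ 2 ≤ (n₀ + n₁) * V₂ := by
    calc (y₂ - y₀) ^ 2 = (y₁ - y₀ + (y₂ - y₁)) ^ 2 := by ring
      _ ≤ _ := hinc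
      _ ≤ _ := mul_le_mul_of_nonneg_left (by linarith) (add_nonneg hn₀ hn₁)
  -- Young's inequality, with its parameter chosen so that (1 + 1/(2T)) · T/(1+T) = (2T+1)/(2T+2) <
  -- 1.
  have a2 : y₂ ^ 2 ≤ (1 + 1 / (2 * T)) * y₀ ^ 2 + (1 + 2 * T) * (y₂ - y₀) ^ 2 := by
    have : (1 + 1 / (2 * T)) * y₀ ^ 2 + (1 + 2 * T) * (y₂ - y₀) ^ 2 - y₂ ^ 2
        = (y₀ - 2 * T * (y₂ - y₀)) ^ 2 / (2 * T) := by
      field_simp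
      ring
    have h : 0 ≤ (y₀ - 2 * T * (y₂ - y₀)) ^ 2 / (2 * T) := by positivity
    linarith
  -- Add V₀ ≤ V₂ to the rearranged hypothesis T V₀ ≤ (T − 1)V₂.
  have a3 : V₀ ≤ T / (1 + T) * V₂ := by
    rw [div_mul_eq_mul_div, le_div_iff₀ (by positivity)]
    nlinarith
  have a4 : (1 + 1 / (2 * T)) * y₀ ^ 2 ≤ (2 * T + 1) / (2 * T + 2) * v * V₂ := by
    calc (1 + 1 / (2 * T)) * y₀ ^ 2 ≤ (1 + 1 / (2 * T)) * (v * (T / (1 + T) * V₂)) := by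
          gcongr
          exact hy₀.trans (mul_le_mul_of_nonneg_left a3 hv)
      _ = _ := by
        field_simp
        ring
  have a5 : (1 + 2 * T) * (y₂ - y₀) ^ 2 ≤ (1 + 2 * T) * ((n₀ + n₁) * V₂) := by gcongr
  linarith

namespace Scenario

variable {Ω : Type*} {M N : ℕ} {S : Scenario Ω M N}

/-- The centred output noise. -/
def β (S : Scenario Ω M N) (j : Fin M) (k : ℕ) (ω : Ω) : ℝ :=
  S.εbar j k ω - ((S.q (S.i j) : ℝ) - (S.q (S.g j) : ℝ))

/-- The normalized size of the noises entering the step from `k` to `k + 1`. -/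
def noise (S : Scenario Ω M N) (qlo rlo : ℝ) (j : Fin M) (k : ℕ) (ω : Ω) : ℝ :=
  (S.acc j k ω ⬝ᵥ S.acc j k ω) / qlo + S.β j (k + 1) ω ^ 2 / rlo

lemma noise_nonneg {qlo rlo : ℝ} (hqlo : 0 < qlo) (hrlo : 0 < rlo) (j : Fin M) (k : ℕ) (ω : Ω) :
    0 ≤ S.noise qlo rlo j k ω :=
  add_nonneg (div_nonneg (dotProduct_self_nonneg_real _) hqlo.le)
    (div_nonneg (sq_nonneg _) hrlo.le)

/-- The squared target position and the drone norms cancel in the difference of squared distances,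
so the measurement is linear in the target state. -/
lemma θ_eq (j : Fin M) (k : ℕ) (ω : Ω) :
    S.θ j k ω = S.C j k ω ⬝ᵥ S.η j k ω + S.εbar j k ω := by
  have h : ∀ h, S.dist h j k ω ^ 2
      = (F *ᵥ S.x h k ω - S.s j k ω) ⬝ᵥ (F *ᵥ S.x h k ω - S.s j k ω) := fun h => eNorm_sq _
  have hi := h (S.i j)
  have hg := h (S.g j)
  rw [θ, εbar, d, d, C, outRow, p, dotProduct_SIdx, mulVec_sub]
  simp only [dotProduct, Fin.sum_univ_two, Pi.sub_apply, s, Sum.elim_inl, Sum.elim_inr,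
    Pi.smul_apply, smul_eq_mul, Pi.zero_apply] at hi hg ⊢
  linear_combination hi - hg

/-- The error follows e⁺ = (1 − KC)(A₂e + B₂ω) − βK; testing with f moves 1 − KC to its transpose,
the dual update. The subtracted q_i − q_g is what centres the noise. -/
lemma dotProduct_e_succ (htarget : ∀ j k ω, S.η j (k + 1) ω
      = A₂ S.t *ᵥ S.η j k ω + B₂ S.t *ᵥ S.acc j k ω) (j : Fin M) (k : ℕ) (ω : Ω)
    (f : SIdx → ℝ) :
    f ⬝ᵥ S.e j (k + 1) ω
      = ((A₂ S.t)ᵀ *ᵥ dualUpdate (predVar S.t (S.Q j) (S.ζ j k ω)) (S.C j (k + 1) ω)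
          (S.Υhat j (k + 1) ω) f) ⬝ᵥ S.e j k ω
        + (((B₂ S.t)ᵀ *ᵥ dualUpdate (predVar S.t (S.Q j) (S.ζ j k ω)) (S.C j (k + 1) ω)
          (S.Υhat j (k + 1) ω) f) ⬝ᵥ S.acc j k ω
          - S.β j (k + 1) ω * (S.K j k ω ⬝ᵥ f)) := by
  set z := A₂ S.t *ᵥ S.e j k ω + B₂ S.t *ᵥ S.acc j k ω with hz
  have he : S.e j (k + 1) ω = z - (S.C j (k + 1) ω ⬝ᵥ z + S.β j (k + 1) ω) • S.K j k ω := by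
    rw [e, ηhat, θ_eq, htarget, hz, e, mulVec_sub]
    simp only [dotProduct_add, dotProduct_sub, β]
    ext a
    simp only [Pi.add_apply, Pi.sub_apply, Pi.smul_apply, smul_eq_mul]
    ring
  have hg : dualUpdate (predVar S.t (S.Q j) (S.ζ j k ω)) (S.C j (k + 1) ω)
      (S.Υhat j (k + 1) ω) f = f - (S.K j k ω ⬝ᵥ f) • S.C j (k + 1) ω := rfl
  set g := dualUpdate (predVar S.t (S.Q j) (S.ζ j k ω)) (S.C j (k + 1) ω)
      (S.Υhat j (k + 1) ω) f
  have hgz : g ⬝ᵥ z = ((A₂ S.t)ᵀ *ᵥ g) ⬝ᵥ S.e j k ω + ((B₂ S.t)ᵀ *ᵥ g) ⬝ᵥ S.acc j k ω := by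
    rw [hz, dotProduct_add, dotProduct_mulVec, dotProduct_mulVec, mulVec_transpose,
      mulVec_transpose]
  have hgz' : g ⬝ᵥ z = f ⬝ᵥ z - (S.K j k ω ⬝ᵥ f) * (S.C j (k + 1) ω ⬝ᵥ z) := by
    rw [hg, sub_dotProduct, smul_dotProduct, smul_eq_mul]
  rw [he, dotProduct_sub, dotProduct_smul, smul_eq_mul, dotProduct_comm f (S.K j k ω)]
  linarith

/-- The dual state one step earlier. -/
def dualState (S : Scenario Ω M N) (j : Fin M) (k : ℕ) (ω : Ω) (f : SIdx → ℝ) : SIdx → ℝ :=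
  (A₂ S.t)ᵀ *ᵥ dualUpdate (predVar S.t (S.Q j) (S.ζ j k ω)) (S.C j (k + 1) ω)
    (S.Υhat j (k + 1) ω) f

/-- Cauchy–Schwarz with weights qlo and rlo: the weight gains at least qlo|B₂ᵀg|² + rlo κ². Only the
lower bound of the supplied variance estimate enters, not its agreement with the true variance. -/
lemma error_increment {qlo rlo : ℝ} (hqlo : 0 < qlo) (hrlo : 0 < rlo)
    (htarget : ∀ j k ω, S.η j (k + 1) ω = A₂ S.t *ᵥ S.η j k ω + B₂ S.t *ᵥ S.acc j k ω)
    {j : Fin M} {k : ℕ} {ω : Ω} (hQ : (S.Q j).PosSemidef)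
    (hQlo : ∀ b, qlo * (b ⬝ᵥ b) ≤ quad (S.Q j) b) (hζ : (S.ζ j k ω).PosDef)
    (hR : rlo ≤ S.Υhat j (k + 1) ω) (f : SIdx → ℝ) :
    quad (S.ζ j k ω) (S.dualState j k ω f) ≤ quad (S.ζ j (k + 1) ω) f ∧
    (f ⬝ᵥ S.e j (k + 1) ω - S.dualState j k ω f ⬝ᵥ S.e j k ω) ^ 2
      ≤ S.noise qlo rlo j k ω
        * (quad (S.ζ j (k + 1) ω) f - quad (S.ζ j k ω) (S.dualState j k ω f)) := by
  have hV := quad_riccati_predVar (t := S.t) (C := S.C j (k + 1) ω) hζ hQ (hrlo.trans_le hR) f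
  rw [← ζ_succ] at hV
  rw [dotProduct_e_succ htarget, dualState, hV]
  set g := dualUpdate (predVar S.t (S.Q j) (S.ζ j k ω)) (S.C j (k + 1) ω)
      (S.Υhat j (k + 1) ω) f
  change _ ∧ (_ + (_ - S.β j (k + 1) ω * (S.K j k ω ⬝ᵥ f)) - _) ^ 2
    ≤ _ * (_ + _ + S.Υhat j (k + 1) ω * (S.K j k ω ⬝ᵥ f) ^ 2 - _)
  change _ ≤ _ + _ + S.Υhat j (k + 1) ω * (S.K j k ω ⬝ᵥ f) ^ 2 ∧ _
  set κ := S.K j k ω ⬝ᵥ f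
  set b := (B₂ S.t)ᵀ *ᵥ g
  have h1 := hQlo b
  have h2 : rlo * κ ^ 2 ≤ S.Υhat j (k + 1) ω * κ ^ 2 :=
    mul_le_mul_of_nonneg_right hR (sq_nonneg κ)
  have h3 := dotProduct_self_nonneg_real b
  have h4 := dotProduct_self_nonneg_real (S.acc j k ω)
  have h5 : 0 ≤ qlo * (b ⬝ᵥ b) := mul_nonneg hqlo.le h3
  have h6 : 0 ≤ rlo * κ ^ 2 := mul_nonneg hrlo.le (sq_nonneg κ)
  have hn := S.noise_nonneg hqlo hrlo j k ω
  refine ⟨by linarith, ?_⟩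
  have key : (b ⬝ᵥ S.acc j k ω + -(S.β j (k + 1) ω * κ)) ^ 2
      ≤ S.noise qlo rlo j k ω * (qlo * (b ⬝ᵥ b) + rlo * κ ^ 2) := by
    refine add_sq_le_add_mul_add (div_nonneg h4 hqlo.le) (div_nonneg (sq_nonneg _) hrlo.le)
      h5 h6 ?_ (le_of_eq ?_)
    · refine (dotProduct_sq_le _ _).trans (le_of_eq ?_)
      field_simp
    · field_simp
  calc _ = (b ⬝ᵥ S.acc j k ω + -(S.β j (k + 1) ω * κ)) ^ 2 := by ring
    _ ≤ _ := key
    _ ≤ _ := mul_le_mul_of_nonneg_left (by linarith) hn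

/-- A dominating sequence for the weighted squared error. -/
def majorant (l D : ℝ) (v₀ : Ω → ℝ) (n : ℕ → Ω → ℝ) : ℕ → Ω → ℝ
  | 0 => v₀
  | 1 => fun ω => v₀ ω + n 0 ω
  | k + 2 => fun ω => l * majorant l D v₀ n k ω + D * (n k ω + n (k + 1) ω)

lemma majorant_nonneg {l D : ℝ} {v₀ : Ω → ℝ} {n : ℕ → Ω → ℝ} (hl : 0 ≤ l) (hD : 0 ≤ D) {ω : Ω}
    (hv : 0 ≤ v₀ ω) (hn : ∀ k, 0 ≤ n k ω) : ∀ k, 0 ≤ majorant l D v₀ n k ω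
  | 0 => hv
  | 1 => add_nonneg hv (hn 0)
  | k + 2 => add_nonneg (mul_nonneg hl (majorant_nonneg hl hD hv hn k))
      (mul_nonneg hD (add_nonneg (hn _) (hn _)))

/-- Pathwise bound of the error by the dominating sequence. -/
lemma dotProduct_e_sq_le_majorant {qlo rlo L z D₀ : ℝ} (hqlo : 0 < qlo) (hrlo : 0 < rlo)
    (hL : 0 < L) (hz : 0 < z) (hD₀ : 0 < D₀)
    (htarget : ∀ j k ω, S.η j (k + 1) ω = A₂ S.t *ᵥ S.η j k ω + B₂ S.t *ᵥ S.acc j k ω)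
    {j : Fin M} {ω : Ω} (hQ : (S.Q j).PosSemidef)
    (hQlo : ∀ b, qlo * (b ⬝ᵥ b) ≤ quad (S.Q j) b) (hζ : ∀ k, (S.ζ j k ω).PosDef)
    (hR : ∀ k, rlo ≤ S.Υhat j k ω) (hζ₀ : ∀ f, f ⬝ᵥ f ≤ D₀ * quad (S.ζ j 0 ω) f)
    (hup : ∀ k f, quad (S.ζ j (k + 1) ω) f ≤ z * (f ⬝ᵥ f))
    (htwo : ∀ k f, f ⬝ᵥ f ≤ L * (quad (S.ζ j (k + 2) ω) f
      - quad (S.ζ j k ω) (S.dualState j k ω (S.dualState j (k + 1) ω f)))) :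
    ∀ k f, (f ⬝ᵥ S.e j k ω) ^ 2
      ≤ majorant ((2 * (z * L) + 1) / (2 * (z * L) + 2)) (1 + 2 * (z * L))
          (fun ω => D₀ * (S.e j 0 ω ⬝ᵥ S.e j 0 ω)) (S.noise qlo rlo j) k ω
        * quad (S.ζ j k ω) f := by
  have hzL : 0 < z * L := mul_pos hz hL
  have hn : ∀ k, 0 ≤ S.noise qlo rlo j k ω := fun k => S.noise_nonneg hqlo hrlo j k ω
  have he := dotProduct_self_nonneg_real (S.e j 0 ω)
  have hmaj := majorant_nonneg (l := (2 * (z * L) + 1) / (2 * (z * L) + 2))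
    (D := 1 + 2 * (z * L)) (v₀ := fun ω => D₀ * (S.e j 0 ω ⬝ᵥ S.e j 0 ω))
    (n := S.noise qlo rlo j) (ω := ω) (by positivity) (by positivity)
    (mul_nonneg hD₀.le he) hn
  have inc := fun k f => error_increment hqlo hrlo htarget hQ hQlo (hζ k) (hR (k + 1)) f
  have zero : ∀ f, (f ⬝ᵥ S.e j 0 ω) ^ 2
      ≤ D₀ * (S.e j 0 ω ⬝ᵥ S.e j 0 ω) * quad (S.ζ j 0 ω) f := fun f =>
    calc (f ⬝ᵥ S.e j 0 ω) ^ 2 ≤ (f ⬝ᵥ f) * (S.e j 0 ω ⬝ᵥ S.e j 0 ω) := dotProduct_sq_le _ _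
      _ ≤ (D₀ * quad (S.ζ j 0 ω) f) * (S.e j 0 ω ⬝ᵥ S.e j 0 ω) :=
        mul_le_mul_of_nonneg_right (hζ₀ f) he
      _ = _ := by ring
  intro k
  induction k using Nat.twoStepInduction with
  | zero => exact zero
  -- Contraction spans two steps, so the odd instants need their own start; here the noise is merely
  -- added.
  | one =>
    intro f
    obtain ⟨h1, h2⟩ := inc 0 f
    have h3 := add_sq_le_add_mul_add (hmaj 0) (hn 0)
      (quad_nonneg (hζ 0).posSemidef (S.dualState j 0 ω f)) (sub_nonneg.2 h1)
      (zero (S.dualState j 0 ω f)) h2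
    simpa [majorant] using h3
  | more k ih _ =>
    intro f
    obtain ⟨h1, h2⟩ := inc (k + 1) f
    obtain ⟨h3, h4⟩ := inc k (S.dualState j (k + 1) ω f)
    have h5 := add_sq_le_add_mul_add (hn k) (hn (k + 1)) (sub_nonneg.2 h3) (sub_nonneg.2 h1) h4 h2
    have h6 := ih (S.dualState j k ω (S.dualState j (k + 1) ω f))
    have h7 := htwo k f
    have h8 := hup (k + 1) f
    have h9 := quad_nonneg (hζ k).posSemidef (S.dualState j k ω (S.dualState j (k + 1) ω f))
    -- Upper bound and controllability combine to the contraction parameter T = zL.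
    have hV := calc quad (S.ζ j (k + 2) ω) f ≤ z * (f ⬝ᵥ f) := h8
      _ ≤ z * (L * _) := mul_le_mul_of_nonneg_left h7 hz.le
      _ = z * L * _ := (mul_assoc _ _ _).symm
    exact sq_le_of_two_step_contraction hzL (hmaj k) (hn k) (hn (k + 1)) h9 h3 h1 h6 h5 hV

end Scenario

namespace Scenario

variable {Ω : Type*} {M N : ℕ} {S : Scenario Ω M N} [MeasurableSpace Ω] {μ : Measure Ω}

/-! ### Measurability of the random gain and of the error. -/

section Measurability

lemma measurable_mulVec {m n : Type*} [Fintype n] {A : Ω → Matrix m n ℝ} {v : Ω → n → ℝ}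
    (hA : ∀ i j, Measurable fun ω => A ω i j) (hv : Measurable v) :
    Measurable fun ω => A ω *ᵥ v ω := by
  refine measurable_pi_lambda _ fun i => ?_
  exact Finset.measurable_sum _ fun j _ => (hA i j).mul ((measurable_pi_apply j).comp hv)

lemma measurable_const_mulVec {m n : Type*} [Fintype n] (A : Matrix m n ℝ) {v : Ω → n → ℝ}
    (hv : Measurable v) : Measurable fun ω => A *ᵥ v ω :=
  measurable_mulVec (A := fun _ => A) (fun _ _ => measurable_const) hv

lemma measurable_dotProduct {n : Type*} [Fintype n] {u v : Ω → n → ℝ} (hu : Measurable u)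
    (hv : Measurable v) : Measurable fun ω => u ω ⬝ᵥ v ω :=
  Finset.measurable_sum _ fun j _ =>
    ((measurable_pi_apply j).comp hu).mul ((measurable_pi_apply j).comp hv)

lemma measurable_matrix_mul {l m n : Type*} [Fintype m] {A : Ω → Matrix l m ℝ}
    {B : Ω → Matrix m n ℝ} (hA : ∀ i j, Measurable fun ω => A ω i j)
    (hB : ∀ i j, Measurable fun ω => B ω i j) (i : l) (j : n) :
    Measurable fun ω => (A ω * B ω) i j :=
  Finset.measurable_sum _ fun k _ => (hA i k).mul (hB k j)

lemma measurable_predVar {t : ℝ} {Q : Matrix (Fin 2) (Fin 2) ℝ} {Z : Ω → Matrix SIdx SIdx ℝ}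
    (hZ : ∀ a b, Measurable fun ω => Z ω a b) (a b : SIdx) :
    Measurable fun ω => predVar t Q (Z ω) a b := by
  unfold predVar
  have h1 := measurable_matrix_mul (A := fun _ : Ω => A₂ t) (fun _ _ => measurable_const) hZ
  have h2 := measurable_matrix_mul (B := fun _ : Ω => (A₂ t)ᵀ) h1 (fun _ _ => measurable_const) a b
  exact h2.add_const ((B₂ t * Q * (B₂ t)ᵀ) a b)

lemma measurable_gain {P : Ω → Matrix SIdx SIdx ℝ} {C : Ω → SIdx → ℝ} {R : Ω → ℝ}
    (hP : ∀ a b, Measurable fun ω => P ω a b) (hC : Measurable C) (hR : Measurable R) :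
    Measurable fun ω => gain (P ω) (C ω) (R ω) := by
  have h := measurable_mulVec hP hC
  exact ((measurable_dotProduct hC h).add hR).inv.smul h

lemma IsModel.measurable_η (hS : S.IsModel μ) (j : Fin M) (k : ℕ) : Measurable (S.η j k) := by
  induction k with
  | zero => exact hS.meas_η₀ j
  | succ k ih =>
    have : S.η j (k + 1) = fun ω => A₂ S.t *ᵥ S.η j k ω + B₂ S.t *ᵥ S.acc j k ω :=
      funext fun ω => hS.target j k ω
    rw [this]
    exact (measurable_const_mulVec _ ih).add
      (measurable_const_mulVec _ (hS.meas_acc j k))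

lemma IsModel.measurable_dist (hS : S.IsModel μ) (h : Fin N) (j : Fin M) (k : ℕ) :
    Measurable (S.dist h j k) := by
  have h1 : Measurable fun ω => F *ᵥ S.x h k ω - S.s j k ω :=
    (measurable_const_mulVec _ (hS.meas_x h k)).sub
      (measurable_pi_lambda (S.s j k) fun a =>
        (measurable_pi_apply (Sum.inl a)).comp (hS.measurable_η j k))
  exact ((WithLp.measurable_toLp 2 _).comp h1).norm

lemma IsModel.measurable_εbar (hS : S.IsModel μ) (j : Fin M) (k : ℕ) : Measurable (S.εbar j k) := by
  have h1 := hS.meas_ε (S.i j) j k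
  have h2 := hS.meas_ε (S.g j) j k
  have h3 := hS.measurable_dist (S.i j) j k
  have h4 := hS.measurable_dist (S.g j) j k
  unfold εbar
  fun_prop

lemma IsModel.measurable_C (hS : S.IsModel μ) (j : Fin M) (k : ℕ) : Measurable (S.C j k) := by
  have h1 : Measurable fun ω => F *ᵥ S.p j k ω :=
    measurable_const_mulVec _ ((hS.meas_x _ k).sub (hS.meas_x _ k))
  refine measurable_pi_lambda _ fun a => ?_
  rcases a with a | a
  · exact ((measurable_pi_apply a).comp h1).const_mul (-2 : ℝ)
  · exact measurable_const

lemma IsModel.measurable_ζ (hS : S.IsModel μ) (j : Fin M) (k : ℕ) (a b : SIdx) :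
    Measurable fun ω => S.ζ j k ω a b := by
  induction k generalizing a b with
  | zero => exact measurable_const
  | succ k ih =>
    have hP := measurable_predVar (t := S.t) (Q := S.Q j) ih
    have hC := hS.measurable_C j (k + 1)
    have hK := measurable_gain hP hC (hS.meas_Υhat j (k + 1))
    refine measurable_matrix_mul (fun i l => ?_) hP a b
    exact measurable_const.sub
      (((measurable_pi_apply i).comp hK).mul ((measurable_pi_apply l).comp hC))

lemma IsModel.measurable_K (hS : S.IsModel μ) (j : Fin M) (k : ℕ) : Measurable (S.K j k) :=
  measurable_gain (measurable_predVar (hS.measurable_ζ j k)) (hS.measurable_C j (k + 1))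
    (hS.meas_Υhat j (k + 1))

lemma IsModel.measurable_ηhat (hS : S.IsModel μ) (j : Fin M) (k : ℕ) : Measurable (S.ηhat j k) := by
  induction k with
  | zero => exact hS.meas_ηhat₀ j
  | succ k ih =>
    have h1 : Measurable fun ω => A₂ S.t *ᵥ S.ηhat j k ω :=
      measurable_const_mulVec _ ih
    have h2 := measurable_dotProduct (hS.measurable_C j (k + 1)) h1
    have h3 : Measurable (S.θ j (k + 1)) := by
      have : S.θ j (k + 1) = fun ω => _ := funext fun ω => θ_eq j (k + 1) ω
      rw [this]
      exact (measurable_dotProduct (hS.measurable_C j (k + 1)) (hS.measurable_η j (k + 1))).add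
        (hS.measurable_εbar j (k + 1))
    exact h1.add ((h3.sub ((h2.add_const _).sub_const _)).smul (hS.measurable_K j k))

lemma IsModel.measurable_e (hS : S.IsModel μ) (j : Fin M) (k : ℕ) : Measurable (S.e j k) :=
  (hS.measurable_η j k).sub (hS.measurable_ηhat j k)

end Measurability

/-! ### Second moments of the noises. -/

section Moments

lemma IsModel.integral_ε_sq (hS : S.IsModel μ) (h : Fin N) (j : Fin M) (k : ℕ) :
    Integrable (fun ω => S.ε h j k ω ^ 2) μ ∧ ∫ ω, S.ε h j k ω ^ 2 ∂μ = S.q h := by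
  have hl := hS.ε_law h j k
  have hm : MemLp (S.ε h j k) 2 μ := hl.hasGaussianLaw.memLp_two
  refine ⟨hm.integrable_sq, ?_⟩
  have h0 : ∫ ω, S.ε h j k ω ∂μ = 0 := by
    rw [hl.integral_eq, integral_id_gaussianReal]
  rw [← variance_of_integral_eq_zero hm.aemeasurable h0, hl.variance_eq, variance_id_gaussianReal]

/-- The part of the output noise that is linear in the distance noises is symmetric. -/
lemma IsModel.integral_linear_noise [IsProbabilityMeasure μ] (hS : S.IsModel μ) (j : Fin M)
    (k : ℕ) :
    ∫ ω, (2 * S.dist (S.i j) j k ω * S.ε (S.i j) j k ω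
      - 2 * S.dist (S.g j) j k ω * S.ε (S.g j) j k ω) ∂μ = 0 := by
  set X := fun ω => (S.x (S.i j) k ω, S.x (S.g j) k ω, S.η j k ω) with hX
  have hXm : Measurable X :=
    (hS.meas_x _ k).prodMk ((hS.meas_x _ k).prodMk (hS.measurable_η j k))
  have hXl : HasLaw X (μ.map X) μ := ⟨hXm.aemeasurable, rfl⟩
  have h1 := hS.ε_law (S.i j) j k
  have h2 := hS.ε_law (S.g j) j k
  have hE := (hS.ε_indep j k).hasLaw_prod h1 h2
  have hE' : HasLaw (fun ω => (-S.ε (S.i j) j k ω, -S.ε (S.g j) j k ω))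
      ((gaussianReal 0 (S.q (S.i j))).prod (gaussianReal 0 (S.q (S.g j)))) μ := by
    have n1 := gaussianReal_neg h1
    have n2 := gaussianReal_neg h2
    rw [neg_zero] at n1 n2
    exact ((hS.ε_indep j k).comp measurable_neg measurable_neg).hasLaw_prod n1 n2
  have hJ := (hS.ε_indep_state j k).hasLaw_prod hE hXl
  have hJ' := ((hS.ε_indep_state j k).comp
    (φ := fun z : ℝ × ℝ => (-z.1, -z.2)) (by fun_prop) measurable_id).hasLaw_prod hE' hXl
  set Φ : (ℝ × ℝ) × ((Fin 3 → ℝ) × (Fin 3 → ℝ) × (SIdx → ℝ)) → ℝ := fun z =>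
    2 * eNorm (F *ᵥ z.2.1 - fun a => z.2.2.2 (.inl a)) * z.1.1
      - 2 * eNorm (F *ᵥ z.2.2.1 - fun a => z.2.2.2 (.inl a)) * z.1.2 with hΦ
  have hnorm : ∀ {y : (ℝ × ℝ) × ((Fin 3 → ℝ) × (Fin 3 → ℝ) × (SIdx → ℝ)) → Fin 3 → ℝ},
      Measurable y → Measurable fun z => eNorm (F *ᵥ y z - fun a => z.2.2.2 (.inl a)) := by
    intro y hy
    have h1 : Measurable fun z : (ℝ × ℝ) × ((Fin 3 → ℝ) × (Fin 3 → ℝ) × (SIdx → ℝ)) =>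
        F *ᵥ y z - fun a => z.2.2.2 (.inl a) :=
      (measurable_const_mulVec _ hy).sub (by fun_prop)
    exact ((WithLp.measurable_toLp 2 _).comp h1).norm
  have hΦm : Measurable Φ :=
    (((hnorm (y := fun z => z.2.1) (by fun_prop)).const_mul 2).mul (by fun_prop)).sub
      (((hnorm (y := fun z => z.2.2.1) (by fun_prop)).const_mul 2).mul (by fun_prop))
  -- Flipping both distance noises preserves their joint law with the state, and Φ is odd in them.
  -- The integral equals its own negative, with no moment of the distances needed.
  have e1 := hJ.integral_comp hΦm.aestronglyMeasurable
  have e2 := hJ'.integral_comp hΦm.aestronglyMeasurable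
  have e3 : ∀ ω, Φ ((-S.ε (S.i j) j k ω, -S.ε (S.g j) j k ω), X ω)
      = -Φ ((S.ε (S.i j) j k ω, S.ε (S.g j) j k ω), X ω) := fun ω => by
    simp only [hΦ]
    ring
  have e4 : ∫ ω, Φ ((-S.ε (S.i j) j k ω, -S.ε (S.g j) j k ω), X ω) ∂μ
      = ∫ ω, Φ ((S.ε (S.i j) j k ω, S.ε (S.g j) j k ω), X ω) ∂μ := e2.trans e1.symm
  simp only [e3, integral_neg] at e4
  change ∫ ω, Φ ((S.ε (S.i j) j k ω, S.ε (S.g j) j k ω), X ω) ∂μ = 0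
  linarith

lemma IsModel.integral_β_sq [IsProbabilityMeasure μ] (hS : S.IsModel μ) {rlo rhi : ℝ}
    (hrlo : 0 < rlo) {j : Fin M} {k : ℕ}
    (hlo : rlo ≤ Var[S.εbar j k; μ]) (hhi : Var[S.εbar j k; μ] ≤ rhi) :
    Integrable (fun ω => S.β j k ω ^ 2) μ ∧ ∫ ω, S.β j k ω ^ 2 ∂μ ≤ rhi := by
  -- `Var` takes the value 0 when square integrability fails; the positive lower bound of Υ excludes
  -- this.
  have hm : MemLp (S.εbar j k) 2 μ :=
    memLp_two_of_variance_ne_zero (hS.measurable_εbar j k).aestronglyMeasurable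
      (hrlo.trans_le hlo).ne'
  have hint : Integrable (S.εbar j k) μ := hm.integrable (by norm_num)
  obtain ⟨i1, m1⟩ := hS.integral_ε_sq (S.i j) j k
  obtain ⟨i2, m2⟩ := hS.integral_ε_sq (S.g j) j k
  have hmean : ∫ ω, S.εbar j k ω ∂μ = (S.q (S.i j) : ℝ) - S.q (S.g j) := by
    have h0 := hS.integral_linear_noise j k
    have h1 : ∀ ω, 2 * S.dist (S.i j) j k ω * S.ε (S.i j) j k ω
        - 2 * S.dist (S.g j) j k ω * S.ε (S.g j) j k ω
        = S.εbar j k ω - (S.ε (S.i j) j k ω ^ 2 - S.ε (S.g j) j k ω ^ 2) := fun ω => by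
      rw [εbar]
      ring
    simp only [h1] at h0
    have i3 : Integrable (fun ω => S.ε (S.i j) j k ω ^ 2 - S.ε (S.g j) j k ω ^ 2) μ := i1.sub i2
    rw [integral_sub hint i3, integral_sub i1 i2, m1, m2] at h0
    linarith
  have hβ : MemLp (S.β j k) 2 μ := hm.sub (memLp_const _)
  refine ⟨hβ.integrable_sq, ?_⟩
  rw [variance_eq_integral hm.aemeasurable, hmean] at hhi
  exact hhi

/-- The second moment depends only on the law, which is the same at all instants. -/
lemma IsModel.integral_acc_sq (hS : S.IsModel μ) (j : Fin M) : ∃ a : ℝ, ∀ k,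
    Integrable (fun ω => S.acc j k ω ⬝ᵥ S.acc j k ω) μ ∧
      ∫ ω, S.acc j k ω ⬝ᵥ S.acc j k ω ∂μ ≤ a := by
  refine ⟨∫ z, ‖z‖ ^ 2 ∂(multivariateGaussian 0 (S.Q j)), fun k => ?_⟩
  have hl := hS.acc_law j k
  have hm := hl.hasGaussianLaw.memLp_two
  have e : ∀ ω, S.acc j k ω ⬝ᵥ S.acc j k ω = ‖WithLp.toLp 2 (S.acc j k ω)‖ ^ 2 := fun ω =>
    (eNorm_sq _).symm
  simp only [e]
  refine ⟨hm.integrable_norm_pow (by norm_num), le_of_eq ?_⟩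
  exact hl.integral_comp (f := fun z => ‖z‖ ^ 2) (by fun_prop)

lemma IsModel.exists_integral_noise_le [IsProbabilityMeasure μ] (hS : S.IsModel μ)
    {qlo qhi rlo rhi : ℝ} (hqlo : 0 < qlo) (hrlo : 0 < rlo)
    (h : S.NoiseBounds μ qlo qhi rlo rhi) (j : Fin M) :
    ∃ b : ℝ, ∀ k, Integrable (S.noise qlo rlo j k) μ ∧ ∫ ω, S.noise qlo rlo j k ω ∂μ ≤ b := by
  obtain ⟨a, ha⟩ := hS.integral_acc_sq j
  refine ⟨a / qlo + rhi / rlo, fun k => ?_⟩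
  obtain ⟨i1, m1⟩ := ha k
  obtain ⟨i2, m2⟩ := hS.integral_β_sq hrlo (h.Υ_lo j (k + 1)) (h.Υ_hi j (k + 1))
  refine ⟨(i1.div_const qlo).add (i2.div_const rlo), ?_⟩
  unfold noise
  rw [integral_add (i1.div_const qlo) (i2.div_const rlo), integral_div, integral_div]
  gcongr

end Moments

/-- The mean obeys m_{k+2} ≤ l m_k + 2Db, whose fixed point is 2Db/(1 − l); the other two summands
cover the starts 0 and 1. -/
lemma integral_majorant_le {l D b : ℝ} {v₀ : Ω → ℝ} {n : ℕ → Ω → ℝ} (hl : 0 ≤ l) (hl1 : l < 1)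
    (hD : 0 ≤ D) (hb : 0 ≤ b) (hv : Integrable v₀ μ) (hv0 : 0 ≤ ∫ ω, v₀ ω ∂μ)
    (hn : ∀ k, Integrable (n k) μ ∧ ∫ ω, n k ω ∂μ ≤ b) :
    ∀ k, Integrable (majorant l D v₀ n k) μ ∧
      ∫ ω, majorant l D v₀ n k ω ∂μ ≤ ∫ ω, v₀ ω ∂μ + b + 2 * D * b / (1 - l) := by
  have hl' : 0 < 1 - l := by linarith
  have h0 : 0 ≤ 2 * D * b / (1 - l) := by positivity
  intro k
  induction k using Nat.twoStepInduction with
  | zero => exact ⟨hv, by simp only [majorant]; linarith⟩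
  | one =>
    refine ⟨hv.add (hn 0).1, ?_⟩
    simp only [majorant]
    rw [integral_add hv (hn 0).1]
    linarith [(hn 0).2]
  | more k ih _ =>
    have i1 := ih.1.const_mul l
    have i2 : Integrable (fun ω => D * (n k ω + n (k + 1) ω)) μ :=
      ((hn k).1.add (hn (k + 1)).1).const_mul D
    refine ⟨i1.add i2, ?_⟩
    simp only [majorant]
    rw [integral_add i1 i2, integral_const_mul, integral_const_mul,
      integral_add (hn k).1 (hn (k + 1)).1]
    set δ := ∫ ω, v₀ ω ∂μ + b + 2 * D * b / (1 - l) with hδ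
    have h1 : l * ∫ ω, majorant l D v₀ n k ω ∂μ ≤ l * δ := mul_le_mul_of_nonneg_left ih.2 hl
    have h2 : D * (∫ ω, n k ω ∂μ + ∫ ω, n (k + 1) ω ∂μ) ≤ D * (b + b) :=
      mul_le_mul_of_nonneg_left (add_le_add (hn k).2 (hn (k + 1)).2) hD
    have h3 : 2 * D * b ≤ (1 - l) * δ := by
      rw [hδ, mul_add, mul_div_cancel₀ _ hl'.ne']
      nlinarith
    linarith

theorem meanSquareBounded_of_varianceBounded [IsProbabilityMeasure μ] (hS : S.IsModel μ)
    {qlo qhi rlo rhi c : ℝ} (hqlo : 0 < qlo) (hrlo : 0 < rlo) (hc : 0 < c)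
    (h : S.NoiseBounds μ qlo qhi rlo rhi) (hgr : S.GroupBounded μ c)
    (hvar : ∀ j, S.VarianceBounded μ j) : S.MeanSquareBounded μ := by
  have target : ∀ j, ∃ δ : ℝ, 0 ≤ δ ∧ ∀ k, Integrable (fun ω => eNorm (S.e j k ω) ^ 2) μ ∧
      ∫ ω, eNorm (S.e j k ω) ^ 2 ∂μ ≤ δ := by
    intro j
    have hQ := h.Q_posSemidef hqlo j
    have hQlo := le_quad_of_smul_one_le (h.Q_lo j)
    obtain ⟨zlo, hzlo, zhi, -, hζb⟩ := hvar j
    obtain ⟨D₀, hD₀, hζ₀⟩ := exists_le_quad (hS.ζ₀_pos j)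
    obtain ⟨z₀, hz₀, hζ₀'⟩ := exists_quad_le (S.ζ₀ j)
    obtain ⟨L, hL, htwo⟩ :=
      exists_two_step_bound (cc := 4 * c) hS.t_pos hqlo hrlo (by positivity)
    obtain ⟨b, hb⟩ := hS.exists_integral_noise_le hqlo hrlo h j
    have hb0 : 0 ≤ b := (integral_nonneg fun ω => noise_nonneg hqlo hrlo j 0 ω).trans (hb 0).2
    -- The assumed bound concerns k > 0 only; z₀ takes care of the initial variance.
    set z := z₀ + zlo⁻¹ with hz
    have hzpos : 0 < z := by positivity
    have hT : 0 < z * L := mul_pos hzpos hL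
    set l := (2 * (z * L) + 1) / (2 * (z * L) + 2) with hl
    have hl0 : 0 ≤ l := by positivity
    have hl1 : l < 1 := by
      rw [hl, div_lt_one (by positivity)]
      linarith
    set v₀ : Ω → ℝ := fun ω => D₀ * (S.e j 0 ω ⬝ᵥ S.e j 0 ω) with hv₀
    have hv₀i : Integrable v₀ μ := by
      have := (hS.init_sq j).integrable_norm_pow (by norm_num)
      refine (Integrable.congr this (ae_of_all _ fun ω => ?_)).const_mul D₀
      exact eNorm_sq _
    have hv₀n : 0 ≤ ∫ ω, v₀ ω ∂μ :=
      integral_nonneg fun ω => mul_nonneg hD₀.le (dotProduct_self_nonneg_real _)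
    have hmaj := integral_majorant_le (D := 1 + 2 * (z * L)) hl0 hl1 (by positivity) hb0 hv₀i
      hv₀n hb
    have hpath : ∀ᵐ ω ∂μ, ∀ k, eNorm (S.e j k ω) ^ 2
        ≤ z * majorant l (1 + 2 * (z * L)) v₀ (S.noise qlo rlo j) k ω := by
      filter_upwards [hζb, h.Υhat_lo j, hgr j] with ω hζb hR hp k
      have hpos := ζ_posDef (hS.ζ₀_pos j) hQ fun k => hrlo.trans_le (hR k)
      have hup : ∀ k f, quad (S.ζ j k ω) f ≤ z * (f ⬝ᵥ f) := by
        intro k f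
        have hf := dotProduct_self_nonneg_real f
        have hzi := inv_pos.2 hzlo
        rcases Nat.eq_zero_or_pos k with rfl | hk
        · exact (hζ₀' f).trans (mul_le_mul_of_nonneg_right (by linarith) hf)
        · exact (quad_le_of_le_inv (hpos k) hzlo (hζb k hk).1 f).trans
            (mul_le_mul_of_nonneg_right (by linarith) hf)
      have key := dotProduct_e_sq_le_majorant hqlo hrlo hL hzpos hD₀ hS.target hQ hQlo hpos hR
        hζ₀ (fun k => hup (k + 1))
        (fun k => htwo _ _ _ _ _ _ hQ hQlo (hpos k) (hR (k + 1)) (hR (k + 2))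
          (S.C_inl_sq_le (hp (k + 1))) (S.C_inl_sq_le (hp (k + 2))) (S.C_inr j (k + 1) ω)
          (S.C_inr j (k + 2) ω)) k (S.e j k ω)
      have hm := majorant_nonneg (l := l) (D := 1 + 2 * (z * L)) (v₀ := v₀) (ω := ω) hl0
        (by positivity) (mul_nonneg hD₀.le (dotProduct_self_nonneg_real _))
        (fun k => noise_nonneg (S := S) hqlo hrlo j k ω) k
      have hk := hup k (S.e j k ω)
      rw [eNorm_sq]
      have hx := dotProduct_self_nonneg_real (S.e j k ω)
      -- With f = e_k this reads |e|⁴ ≤ v z |e|²; one factor |e|² is cancelled unless it vanishes.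
      have h1 := key.trans (mul_le_mul_of_nonneg_left hk hm)
      rcases hx.eq_or_lt with h0 | h0
      · rw [← h0]
        exact mul_nonneg hzpos.le hm
      · refine le_of_mul_le_mul_right ?_ h0
        linarith
    refine ⟨z * (∫ ω, v₀ ω ∂μ + b + 2 * (1 + 2 * (z * L)) * b / (1 - l)), ?_, fun k => ?_⟩
    · have : 0 < 1 - l := by linarith
      positivity
    · have hi := (hmaj k).1.const_mul z
      have hint : Integrable (fun ω => eNorm (S.e j k ω) ^ 2) μ := by
        refine hi.mono' ?_ ?_
        · simp only [eNorm_sq]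
          exact (measurable_dotProduct (hS.measurable_e j k)
            (hS.measurable_e j k)).aestronglyMeasurable
        · filter_upwards [hpath] with ω hω
          rw [Real.norm_of_nonneg (sq_nonneg _)]
          exact hω k
      refine ⟨hint, ?_⟩
      calc ∫ ω, eNorm (S.e j k ω) ^ 2 ∂μ
          ≤ ∫ ω, z * majorant l (1 + 2 * (z * L)) v₀ (S.noise qlo rlo j) k ω ∂μ :=
            integral_mono_ae hint hi (hpath.mono fun ω hω => hω k)
        _ = z * ∫ ω, majorant l (1 + 2 * (z * L)) v₀ (S.noise qlo rlo j) k ω ∂μ :=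
            integral_const_mul _ _
        _ ≤ _ := mul_le_mul_of_nonneg_left (hmaj k).2 hzpos.le
  choose δ hδ hbound using target
  -- The sum is a common bound for all targets, also when there are none.
  refine ⟨∑ j, δ j, Finset.sum_nonneg fun j _ => hδ j, fun j k => ⟨(hbound j k).1, ?_⟩⟩
  exact (hbound j k).2.trans (Finset.single_le_sum (fun i _ => hδ i) (Finset.mem_univ j))

end Scenario

end DTSE

end

theorem theorem1 {Ω : Type*} [MeasurableSpace Ω] (μ : MeasureTheory.Measure Ω)
    [MeasureTheory.IsProbabilityMeasure μ] {M N : ℕ} (S : DTSE.Scenario Ω M N)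
    (hS : S.IsModel μ)
    (qlo qhi rlo rhi c : ℝ) (hqlo : 0 < qlo) (hqhi : 0 < qhi) (hrlo : 0 < rlo) (hrhi : 0 < rhi)
    (hc : 0 < c)
    (hnoise : S.NoiseBounds μ qlo qhi rlo rhi)
    (hgroup : S.GroupBounded μ c) :
    ((∀ j, S.VarianceBounded μ j) → S.MeanSquareBounded μ) ∧
    (∀ (ρ : ℝ) (ℓ : ℕ) (Γaux : Fin N → ℕ → Ω → Fin 3 → ℝ), 0 < ρ → 4 ≤ ℓ →
      ∀ j, S.Encircles ρ ℓ Γaux j → S.QuietWindows μ Γaux j → S.VarianceBounded μ j) := by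
  refine ⟨fun hvar => DTSE.Scenario.meanSquareBounded_of_varianceBounded hS hqlo hrlo hc hnoise
    hgroup hvar, fun ρ ℓ Γaux hρ hℓ j henc hqw => ?_⟩
  exact DTSE.Scenario.varianceBounded_of_encircles hS hnoise hgroup hqlo hqhi hrlo hrhi hc hρ hℓ
    henc hqw
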